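/- Consider coordinates $(t,r,\theta,\phi)$ and the exterior $r>r_H>0$ of a stationary, axisymmetric, circular black hole with metric $$ds^2=-N^2dt^2+A^2dr^2+r^2B^2\{d\theta^2+\sin^2\theta\,(d\phi-\omega\,dt)^2\},$$ where $N,A,B>0$ and $\omega$ are functions of $(r,\theta)$ that are smooth (on the symmetry axis too) and invariant under $\theta\mapsto\pi-\theta$. Assume that $r=r_H$ is a regular null horizon generated by $X=\partial_t+\Omega_H\partial_\phi$: the functions $N^2$, $NA$, $B$, $\omega$ extend smoothly to $r=r_H$, with $N=0$, $NA>0$, $B>0$, $\omega=\Omega_H$ there. Assume that the coordinates are asymptotically mass centered: for some constants $M,J$, as $r\to\infty$, $$N=1-\frac Mr+O(r^{-2}),\quad A=1+\frac Mr+O(r^{-2}),\quad B=1+O(r^{-2}),\quad \omega=\frac{2J}{r^3}+O(r^{-4}).$$ Here and below, $O(r^{-k})$ (in particular the remainders of $\Phi$ and $\phi_0$) is uniform in $\theta$ and may be differentiated termwise up to twice (each $r$-derivative gains a factor $r^{-1}$). Let ${}^*RR=R_{\beta\alpha\gamma\delta}{}^*R^{\alpha\beta\gamma\delta}$ with ${}^*R^{\alpha\beta\gamma\delta}=\frac12\epsilon^{\gamma\delta\rho\sigma}R^{\alpha\beta}{}_{\rho\sigma}$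 and $\epsilon_{tr\theta\phi}=\sqrt{-g}$ be the Pontryagin density, and assume that it falls off at least as $r^{-5}$, uniformly in $\theta$. Let $\epsilon\in\mathbb R$ and let $\Phi(r,\theta)$ be a scalar, smooth for $r>r_H$, on the axis and up to the horizon $r=r_H$, that solves the dynamical Chern–Simons scalar equation $\Box\Phi+\epsilon\,{}^*RR=0$ and has an expansion $$\Phi=\frac{\mu_1(\theta)}r+\frac{\mu_2(\theta)}{r^2}+O(r^{-3}),$$ with $\mu_1,\mu_2$ regular (smooth on the sphere). Let $\mu_{(2,\ell)}=\frac{2\ell+1}2\int_0^\pi\mu_2(\theta)P_\ell(\cos\theta)\sin\theta\,d\theta$ be the $\ell$-th Legendre coefficient of $\mu_2$. Then: 1. $\mu_1(\theta)=0$ for all $\theta$, and $\mu_{(2,0)}=0$. 2. $\mu_2(\theta)=\mu_{(2,1)}P_1(\cos\theta)$, so that $\Phi=\dfrac{\mu_{(2,1)}P_1(\cos\theta)}{r^2}+O(r^{-3})$. 3. Let $\phi_0(r,\theta)$ be any solution of $\Box\phi_0=0$ for $r>r_H$ that is smooth on the axis and up to the horizon and satisfies $\phi_0=rP_1(\cos\theta)+\psi(\theta)+O(r^{-1})$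 for some regular $\psi$. Let $\Sigma$ be any hypersurface $t=h(r,\theta,\phi)$, $r>r_H$, with $h$ of class $C^1$, $2\pi$-periodic in $\phi$, and $\partial_\phi h$ bounded (for instance $t=\mathrm{const}$), with surface element $d\Sigma_\mu=\partial_\mu(t-h)\sqrt{-g}\,dr\,d\theta\,d\phi$. Then $\epsilon\,{}^*RR\,\phi_0\,X^\mu d\Sigma_\mu$ is absolutely integrable over $\Sigma$ and $$\mu_{(2,1)}=\frac{\epsilon}{4\pi}\int_\Sigma R_{\beta\alpha\gamma\delta}{}^*R^{\alpha\beta\gamma\delta}\,\phi_0\,X^\mu\,d\Sigma_\mu .$$ -/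

import Mathlib

open scoped ContDiff

noncomputable section

namespace DCS

/-! ## Lorentzian geometry in a coordinate chart of `ℝ⁴`

`g x` is the matrix of the metric components `g_{μν}` at the coordinate point `x`. -/

/-- The coordinate derivative `∂_μ f` at `x`. -/
def pd (μ : Fin 4) (f : (Fin 4 → ℝ) → ℝ) (x : Fin 4 → ℝ) : ℝ :=
  fderiv ℝ f x (Pi.single μ 1)

/-- `√(-det g)`. -/
def volDensity (g : (Fin 4 → ℝ) → Matrix (Fin 4) (Fin 4) ℝ) (x : Fin 4 → ℝ) : ℝ :=
  Real.sqrt (-(g x).det)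

/-- `□f = ∇_μ ∇^μ f = (1/√(-g)) ∂_μ (√(-g) g^{μν} ∂_ν f)`. -/
def box (g : (Fin 4 → ℝ) → Matrix (Fin 4) (Fin 4) ℝ) (f : (Fin 4 → ℝ) → ℝ)
    (x : Fin 4 → ℝ) : ℝ :=
  (1 / volDensity g x) *
    ∑ μ, pd μ (fun y => volDensity g y * ∑ ν, (g y)⁻¹ μ ν * pd ν f y) x

/-- The Christoffel symbol `Γ^l_{mn}`. -/
def christoffel (g : (Fin 4 → ℝ) → Matrix (Fin 4) (Fin 4) ℝ) (l m n : Fin 4)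
    (x : Fin 4 → ℝ) : ℝ :=
  (1 / 2) * ∑ s, (g x)⁻¹ l s *
    (pd m (fun y => g y s n) x + pd n (fun y => g y s m) x - pd s (fun y => g y m n) x)

/-- The Riemann tensor
`R^a_{bcd} = ∂_c Γ^a_{db} - ∂_d Γ^a_{cb} + Γ^a_{ce} Γ^e_{db} - Γ^a_{de} Γ^e_{cb}`. -/
def riemann (g : (Fin 4 → ℝ) → Matrix (Fin 4) (Fin 4) ℝ) (a b c d : Fin 4)
    (x : Fin 4 → ℝ) : ℝ :=
  pd c (christoffel g a d b) x - pd d (christoffel g a c b) x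
    + ∑ e, (christoffel g a c e x * christoffel g e d b x
      - christoffel g a d e x * christoffel g e c b x)

/-- `R_{abcd}`. -/
def riemannDown (g : (Fin 4 → ℝ) → Matrix (Fin 4) (Fin 4) ℝ) (a b c d : Fin 4)
    (x : Fin 4 → ℝ) : ℝ :=
  ∑ e, g x a e * riemann g e b c d x

/-- `R^{ab}_{cd}`. -/
def riemannUpUp (g : (Fin 4 → ℝ) → Matrix (Fin 4) (Fin 4) ℝ) (a b c d : Fin 4)
    (x : Fin 4 → ℝ) : ℝ :=
  ∑ e, (g x)⁻¹ b e * riemann g a e c d x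

/-- The totally antisymmetric symbol with `[0123] = 1`. -/
def leviCivitaSymbol (a b c d : Fin 4) : ℝ :=
  Matrix.det (fun i j : Fin 4 => if ![a, b, c, d] i = j then (1 : ℝ) else 0)

/-- The Levi-Civita tensor `ε^{abcd}`, oriented so that `ε_{0123} = √(-g)`, i.e.
`ε^{0123} = -1 / √(-g)`. -/
def leviCivitaTensor (g : (Fin 4 → ℝ) → Matrix (Fin 4) (Fin 4) ℝ) (a b c d : Fin 4)
    (x : Fin 4 → ℝ) : ℝ :=
  -leviCivitaSymbol a b c d / volDensity g x

/-- The dual `*R^{abcd} = (1/2) ε^{cdef} R^{ab}_{ef}`. -/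
def dualRiemann (g : (Fin 4 → ℝ) → Matrix (Fin 4) (Fin 4) ℝ) (a b c d : Fin 4)
    (x : Fin 4 → ℝ) : ℝ :=
  (1 / 2) * ∑ e, ∑ f, leviCivitaTensor g c d e f x * riemannUpUp g a b e f x

/-- The Pontryagin density `R_{bacd} *R^{abcd}`. -/
def pontryagin (g : (Fin 4 → ℝ) → Matrix (Fin 4) (Fin 4) ℝ) (x : Fin 4 → ℝ) : ℝ :=
  ∑ a, ∑ b, ∑ c, ∑ d, riemannDown g b a c d x * dualRiemann g a b c d x

/-! ## Regular functions of `(r, θ)` and expansions in `1/r`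

A function of the polar angle is regular on the sphere, axis included, exactly when it is the
restriction to `[0, π]` of a smooth even `2π`-periodic function on `ℝ`; all functions of `θ`
are therefore taken on `ℝ` with these symmetries. -/

/-- `f` is even and `2π`-periodic. -/
def AxisSymm (f : ℝ → ℝ) : Prop :=
  (∀ θ, f (-θ) = f θ) ∧ ∀ θ, f (θ + 2 * Real.pi) = f θ

/-- A regular (smooth) function of `θ` on the sphere. -/
def RegularAngular (f : ℝ → ℝ) : Prop :=
  ContDiff ℝ ∞ f ∧ AxisSymm f

/-- `f (r, θ)`, given for `r > rH`, is smooth and extends smoothly to `r = rH`, where it takes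
the values `b θ`. -/
def ExtendsSmoothly (rH : ℝ) (f : ℝ → ℝ → ℝ) (b : ℝ → ℝ) : Prop :=
  ∃ F : ℝ × ℝ → ℝ, ContDiff ℝ ∞ F ∧ (∀ r θ, rH < r → F (r, θ) = f r θ) ∧
    ∀ θ, F (rH, θ) = b θ

/-- A stationary axisymmetric scalar that is smooth on `r > rH`, on the axis, and up to and
including the horizon `r = rH`. -/
def RegularScalar (rH : ℝ) (f : ℝ → ℝ → ℝ) : Prop :=
  (∃ b, ExtendsSmoothly rH f b) ∧ ∀ r, rH < r → AxisSymm (f r)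

/-- `E = 𝒪(r^{-k})` as `r → ∞`, uniformly in `θ`, where the estimate may be differentiated
up to twice: `∂_r^i ∂_θ^j E = 𝒪(r^{-k-i})`. -/
def IsRemainder (k : ℕ) (E : ℝ → ℝ → ℝ) : Prop :=
  ∀ i j : ℕ, i + j ≤ 2 → ∃ C R : ℝ, 0 < R ∧ ∀ r θ : ℝ, R < r →
    |iteratedDeriv i (fun s => iteratedDeriv j (E s) θ) r| ≤ C / r ^ (k + i)

/-! ## Hartle–Thorne type black hole metrics, coordinates `x = (t, r, θ, φ)` -/

/-- The functions of `(r, θ)` in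
`ds² = -N² dt² + A² dr² + r² B² (dθ² + sin² θ (dφ - w dt)²)`. -/
structure HTMetric where
  N : ℝ → ℝ → ℝ
  A : ℝ → ℝ → ℝ
  B : ℝ → ℝ → ℝ
  w : ℝ → ℝ → ℝ

/-- The matrix of metric components. -/
def HTMetric.g (m : HTMetric) (x : Fin 4 → ℝ) : Matrix (Fin 4) (Fin 4) ℝ :=
  let r := x 1
  let θ := x 2
  let S := r ^ 2 * m.B r θ ^ 2 * Real.sin θ ^ 2
  !![-m.N r θ ^ 2 + S * m.w r θ ^ 2, 0, 0, -(S * m.w r θ);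
     0, m.A r θ ^ 2, 0, 0;
     0, 0, r ^ 2 * m.B r θ ^ 2, 0;
     -(S * m.w r θ), 0, 0, S]

/-- The exterior of the horizon, without the axis (where the coordinates degenerate). -/
def exterior (rH : ℝ) : Set (Fin 4 → ℝ) :=
  {x | rH < x 1 ∧ 0 < x 2 ∧ x 2 < Real.pi}

/-- The exterior `r > rH` of a black hole: the metric is Lorentzian and regular on the axis and
symmetric under the reflection `θ ↦ π - θ`, and `r = rH` is a regular horizon, i.e. `N²`, `N A`
(hence the volume density), `B` and `w` extend smoothly to `r = rH`, the volume density
being nonzero there, and `X = ∂_t + ΩH ∂_φ` is its null generator: `N = 0` and `w = ΩH`. -/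
structure IsBlackHole (m : HTMetric) (rH ΩH : ℝ) : Prop where
  rH_pos : 0 < rH
  pos : ∀ r θ, rH < r → 0 < m.N r θ ∧ 0 < m.A r θ ∧ 0 < m.B r θ
  axis : ∀ r, rH < r →
    AxisSymm (m.N r) ∧ AxisSymm (m.A r) ∧ AxisSymm (m.B r) ∧ AxisSymm (m.w r)
  reflection : ∀ r θ, rH < r →
    m.N r (Real.pi - θ) = m.N r θ ∧ m.A r (Real.pi - θ) = m.A r θ ∧
    m.B r (Real.pi - θ) = m.B r θ ∧ m.w r (Real.pi - θ) = m.w r θ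
  horizon_N : ExtendsSmoothly rH (fun r θ => m.N r θ ^ 2) (fun _ => 0)
  horizon_NA : ∃ b, ExtendsSmoothly rH (fun r θ => m.N r θ * m.A r θ) b ∧ ∀ θ, 0 < b θ
  horizon_B : ∃ b, ExtendsSmoothly rH m.B b ∧ ∀ θ, 0 < b θ
  horizon_w : ExtendsSmoothly rH m.w (fun _ => ΩH)

/-- The coordinates are asymptotically mass centered, with mass `M` and angular momentum `J`. -/
structure IsAMC (m : HTMetric) (M J : ℝ) : Prop where
  N_exp : IsRemainder 2 (fun r θ => m.N r θ - (1 - M / r))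
  A_exp : IsRemainder 2 (fun r θ => m.A r θ - (1 + M / r))
  B_exp : IsRemainder 2 (fun r θ => m.B r θ - 1)
  w_exp : IsRemainder 4 (fun r θ => m.w r θ - 2 * J / r ^ 3)

/-- A curvature scalar falls off at least as `r^{-5}`. -/
def FallsOff (rH : ℝ) (S : (Fin 4 → ℝ) → ℝ) : Prop :=
  ∃ C R : ℝ, 0 < R ∧ ∀ x ∈ exterior rH, R < x 1 → |S x| ≤ C / x 1 ^ 5

/-- A function of `(r, θ)` as a stationary axisymmetric function on spacetime. -/
def lift (f : ℝ → ℝ → ℝ) (x : Fin 4 → ℝ) : ℝ := f (x 1) (x 2)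

/-- `□Φ + ε *RR = 0` outside the horizon. -/
def SolvesDCS (m : HTMetric) (rH ε : ℝ) (Φ : ℝ → ℝ → ℝ) : Prop :=
  ∀ x ∈ exterior rH, box m.g (lift Φ) x + ε * pontryagin m.g x = 0

/-- The Legendre polynomial `P_l`, by Rodrigues' formula. -/
def legendreP (l : ℕ) (ξ : ℝ) : ℝ :=
  iteratedDeriv l (fun y => (y ^ 2 - 1) ^ l) ξ / (2 ^ l * (l.factorial : ℝ))

/-- The coefficient of `P_l (cos θ)` in the Legendre expansion of `f`. -/
def mode (l : ℕ) (f : ℝ → ℝ) : ℝ :=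
  (2 * (l : ℝ) + 1) / 2 *
    ∫ θ in (0 : ℝ)..Real.pi, f θ * legendreP l (Real.cos θ) * Real.sin θ

/-- `φ₀` is a stationary axisymmetric solution of `□φ₀ = 0` that is regular at the horizon and
has an expansion in powers of `1/r` with leading term `r P₁(cos θ)`. -/
structure IsGreenSolution (m : HTMetric) (rH : ℝ) (φ₀ : ℝ → ℝ → ℝ) : Prop where
  regular : RegularScalar rH φ₀
  homogeneous : ∀ x ∈ exterior rH, box m.g (lift φ₀) x = 0
  expansion : ∃ ψ : ℝ → ℝ, RegularAngular ψ ∧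
    IsRemainder 1 (fun r θ => φ₀ r θ - (r * legendreP 1 (Real.cos θ) + ψ θ))

/-! ## Integrals over hypersurfaces from the horizon to spatial infinity -/

/-- The hypersurface `Σ : t = h (r, θ, φ)`, `r > rH`. No causal condition is needed, so this
covers all partial Cauchy surfaces of this form, `t = const` among them. -/
structure IsSlice (rH : ℝ) (h : ℝ → ℝ → ℝ → ℝ) : Prop where
  smooth : ContDiffOn ℝ 1 (fun p : ℝ × ℝ × ℝ => h p.1 p.2.1 p.2.2)
    (Set.Ioi rH ×ˢ Set.Ioo 0 Real.pi ×ˢ Set.univ)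
  periodic : ∀ r θ φ, h r θ (φ + 2 * Real.pi) = h r θ φ
  bounded : ∃ K, ∀ r θ φ, rH < r → 0 < θ → θ < Real.pi → |deriv (h r θ) φ| ≤ K

/-- Parameter domain `(r, θ, φ)` of the hypersurface. -/
def sliceDomain (rH : ℝ) : Set (ℝ × ℝ × ℝ) :=
  Set.Ioi rH ×ˢ Set.Ioo 0 Real.pi ×ˢ Set.Ioo 0 (2 * Real.pi)

/-- The point of `Σ` with parameters `(r, θ, φ)`. -/
def slicePoint (h : ℝ → ℝ → ℝ → ℝ) (p : ℝ × ℝ × ℝ) : Fin 4 → ℝ :=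
  ![h p.1 p.2.1 p.2.2, p.1, p.2.1, p.2.2]

/-- Density of the surface element, `dΣ_μ = ∂_μ (t - h) √(-g) dr dθ dφ`. -/
def surfaceElement (g : (Fin 4 → ℝ) → Matrix (Fin 4) (Fin 4) ℝ) (h : ℝ → ℝ → ℝ → ℝ)
    (μ : Fin 4) (x : Fin 4 → ℝ) : ℝ :=
  pd μ (fun y => y 0 - h (y 1) (y 2) (y 3)) x * volDensity g x

/-- The integrand of `∫_Σ S X^μ dΣ_μ` in `dr dθ dφ`, with `X = ∂_t + ΩH ∂_φ`. -/
def fluxDensity (g : (Fin 4 → ℝ) → Matrix (Fin 4) (Fin 4) ℝ) (ΩH : ℝ)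
    (h : ℝ → ℝ → ℝ → ℝ) (S : (Fin 4 → ℝ) → ℝ) (p : ℝ × ℝ × ℝ) : ℝ :=
  S (slicePoint h p) *
    ∑ μ, (![1, 0, 0, ΩH] : Fin 4 → ℝ) μ * surfaceElement g h μ (slicePoint h p)

end DCS

end

/-!
Green's identity for the wave operator, applied to `Φ` and a solution `v` of `□v = 0`, turns the
source `ε *RR v` into the flux of the Wronskian `v ∂Φ - Φ ∂v` through the boundary of the exterior.
Since `√(-g) g^{rr}` is proportional to `N / A = N² / (N A)`, the flux through the horizon vanishes,
and `√(-g) g^{θθ}` is proportional to `sin θ`, so that the axis does not contribute either. What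
remains is the flux at infinity, which only sees the leading terms of `v` and `Φ`. With `v = 1` it
is a multiple of the monopole `μ₁`, and with `v = φ₀ ∼ r cos θ` a multiple of the dipole
coefficient of `μ₂`. The monopole vanishes because `*RR` is odd under the equatorial reflection
`θ ↦ π - θ`.

The angular profiles are determined by the fall-off of the source: it forces the leading term
`f(θ) r ^ (-(l + 1))` of `Φ` to satisfy Legendre's equation of degree `l`, whose regular solutions
are the constants for `l = 0` and the multiples of `cos θ` for `l = 1`.
-/

namespace DCS

open Filter Topology MeasureTheory Set
open scoped Real

/-! ## Parity under the equatorial reflection -/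

/-- The linear part of the equatorial reflection in the coordinates `(t, r, θ, φ)`. -/
def reflectLinear : (Fin 4 → ℝ) ≃L[ℝ] (Fin 4 → ℝ) :=
  ContinuousLinearEquiv.piCongrRight fun i =>
    if i = 2 then ContinuousLinearEquiv.neg ℝ else ContinuousLinearEquiv.refl ℝ ℝ

/-- The equatorial reflection `θ ↦ π - θ` in the coordinates `(t, r, θ, φ)`. -/
noncomputable def reflect (x : Fin 4 → ℝ) : Fin 4 → ℝ := reflectLinear x + Pi.single 2 Real.pi

/-- The eigenvalue of `reflectLinear` on `∂_i`, i.e. the sign that the component of a tensor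
acquires under the reflection for each index `i`. -/
def reflSign (i : Fin 4) : ℝ := if i = 2 then -1 else 1

/-- `f` has parity `σ` under the equatorial reflection, at the points of `s`. -/
def HasParityOn (s : Set (Fin 4 → ℝ)) (σ : ℝ) (f : (Fin 4 → ℝ) → ℝ) : Prop :=
  ∀ x ∈ s, f (reflect x) = σ * f x

/-- The equatorial reflection is an isometry of the metric `g`, at the points of `s`. -/
def ReflectionInvariantOn (s : Set (Fin 4 → ℝ)) (g : (Fin 4 → ℝ) → Matrix (Fin 4) (Fin 4) ℝ) :
    Prop :=
  ∀ i j, HasParityOn s (reflSign i * reflSign j) fun x => g x i j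

lemma reflSign_mul_self (i : Fin 4) : reflSign i * reflSign i = 1 := by
  unfold reflSign; split_ifs <;> norm_num

lemma prod_reflSign : ∏ i, reflSign i = -1 := by simp [reflSign]

lemma diagonal_reflSign_mul_self :
    Matrix.diagonal reflSign * Matrix.diagonal reflSign = 1 := by
  simp only [Matrix.diagonal_mul_diagonal, reflSign_mul_self, Matrix.diagonal_one]

lemma reflectLinear_apply (x : Fin 4 → ℝ) (i : Fin 4) :
    reflectLinear x i = reflSign i * x i := by
  simp only [reflectLinear, reflSign, ContinuousLinearEquiv.piCongrRight_apply]
  split_ifs <;> simp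

lemma reflectLinear_single (i : Fin 4) :
    reflectLinear (Pi.single i 1) = reflSign i • (Pi.single i 1 : Fin 4 → ℝ) := by
  ext j
  rw [reflectLinear_apply]
  obtain rfl | h := eq_or_ne j i <;> simp [*]

lemma reflect_apply_two (x : Fin 4 → ℝ) : reflect x 2 = Real.pi - x 2 := by
  simp [reflect, reflectLinear_apply, reflSign, neg_add_eq_sub]

lemma reflect_apply_of_ne {i : Fin 4} (hi : i ≠ 2) (x : Fin 4 → ℝ) : reflect x i = x i := by
  simp [reflect, reflectLinear_apply, reflSign, hi]

lemma fderiv_comp_reflect (f : (Fin 4 → ℝ) → ℝ) (x : Fin 4 → ℝ) :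
    fderiv ℝ (fun y => f (reflect y)) x
      = (fderiv ℝ f (reflect x)).comp (reflectLinear : (Fin 4 → ℝ) →L[ℝ] (Fin 4 → ℝ)) := by
  change fderiv ℝ ((fun z => f (z + Pi.single 2 Real.pi)) ∘ reflectLinear) x = _
  rw [ContinuousLinearEquiv.comp_right_fderiv, fderiv_comp_add_right]
  rfl

lemma pd_comp_reflect (i : Fin 4) (f : (Fin 4 → ℝ) → ℝ) (x : Fin 4 → ℝ) :
    pd i (fun y => f (reflect y)) x = reflSign i * pd i f (reflect x) := by
  simp only [pd, fderiv_comp_reflect, ContinuousLinearMap.comp_apply,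
    ContinuousLinearEquiv.coe_coe, reflectLinear_single, map_smul, smul_eq_mul]

section Parity

variable {s : Set (Fin 4 → ℝ)} {σ τ : ℝ} {f f' : (Fin 4 → ℝ) → ℝ}

lemma HasParityOn.of_sign_eq (hf : HasParityOn s σ f) (h : σ = τ) : HasParityOn s τ f := h ▸ hf

lemma HasParityOn.add (hf : HasParityOn s σ f) (hf' : HasParityOn s σ f') :
    HasParityOn s σ fun x => f x + f' x := fun x hx => by
  linear_combination hf x hx + hf' x hx

lemma HasParityOn.sub (hf : HasParityOn s σ f) (hf' : HasParityOn s σ f') :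
    HasParityOn s σ fun x => f x - f' x := fun x hx => by
  linear_combination hf x hx - hf' x hx

lemma HasParityOn.mul (hf : HasParityOn s σ f) (hf' : HasParityOn s τ f') :
    HasParityOn s (σ * τ) fun x => f x * f' x := fun x hx => by
  linear_combination f' (reflect x) * hf x hx + σ * f x * hf' x hx

lemma HasParityOn.const_mul (c : ℝ) (hf : HasParityOn s σ f) :
    HasParityOn s σ fun x => c * f x := fun x hx => by
  linear_combination c * hf x hx

lemma HasParityOn.sum {ι : Type*} [Fintype ι] {F : ι → (Fin 4 → ℝ) → ℝ}
    (hF : ∀ i, HasParityOn s σ (F i)) : HasParityOn s σ fun x => ∑ i, F i x := fun x hx =>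
  (Finset.sum_congr rfl fun i _ => hF i x hx).trans (Finset.mul_sum _ _ _).symm

lemma HasParityOn.pd (hs : IsOpen s) (hf : HasParityOn s σ f) (i : Fin 4) :
    HasParityOn s (reflSign i * σ) (pd i f) := by
  intro x hx
  have comp_reflect_eq : (fun y => f (reflect y)) =ᶠ[𝓝 x] σ • f :=
    eventually_of_mem (hs.mem_nhds hx) hf
  have pd_comp : DCS.pd i (fun y => f (reflect y)) x = σ * DCS.pd i f x := by
    rw [DCS.pd, comp_reflect_eq.fderiv_eq, fderiv_const_smul_field]
    rfl
  rw [pd_comp_reflect] at pd_comp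
  linear_combination reflSign i * pd_comp
    - DCS.pd i f (reflect x) * reflSign_mul_self i

end Parity

namespace ReflectionInvariantOn

variable {s : Set (Fin 4 → ℝ)} {g : (Fin 4 → ℝ) → Matrix (Fin 4) (Fin 4) ℝ}

lemma apply_reflect (hg : ReflectionInvariantOn s g) {x : Fin 4 → ℝ} (hx : x ∈ s) :
    g (reflect x) = Matrix.diagonal reflSign * g x * Matrix.diagonal reflSign := by
  ext i j
  rw [Matrix.mul_diagonal, Matrix.diagonal_mul]
  linear_combination hg i j x hx

lemma inv (hg : ReflectionInvariantOn s g) : ReflectionInvariantOn s fun x => (g x)⁻¹ := by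
  have diagonal_inv : (Matrix.diagonal reflSign)⁻¹ = Matrix.diagonal reflSign :=
    Matrix.inv_eq_right_inv diagonal_reflSign_mul_self
  intro i j x hx
  simp only [hg.apply_reflect hx, Matrix.mul_inv_rev, diagonal_inv, ← mul_assoc,
    Matrix.mul_diagonal, Matrix.diagonal_mul]
  ring

lemma volDensity_reflect (hg : ReflectionInvariantOn s g) {x : Fin 4 → ℝ} (hx : x ∈ s) :
    volDensity g (reflect x) = volDensity g x := by
  have det_mul_det := congrArg Matrix.det diagonal_reflSign_mul_self
  rw [Matrix.det_mul, Matrix.det_one] at det_mul_det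
  rw [volDensity, volDensity, hg.apply_reflect hx, Matrix.det_mul, Matrix.det_mul]
  congr 2
  linear_combination (g x).det * det_mul_det

lemma hasParityOn_christoffel (hg : ReflectionInvariantOn s g) (hs : IsOpen s) (l m n : Fin 4) :
    HasParityOn s (reflSign l * reflSign m * reflSign n) (christoffel g l m n) := by
  have parity_pd (i j k e : Fin 4) (h : reflSign i * (reflSign j * reflSign k)
      = reflSign e * reflSign m * reflSign n) :=
    ((hg j k).pd hs i).of_sign_eq h
  refine .const_mul _ (.sum fun e => ((hg.inv l e).mul (((parity_pd m e n e (by ring)).add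
    (parity_pd n e m e (by ring))).sub (parity_pd e m n e (by ring)))).of_sign_eq ?_)
  linear_combination reflSign l * reflSign m * reflSign n * reflSign_mul_self e

lemma hasParityOn_riemann (hg : ReflectionInvariantOn s g) (hs : IsOpen s) (a b c d : Fin 4) :
    HasParityOn s (reflSign a * reflSign b * reflSign c * reflSign d) (riemann g a b c d) := by
  have parity_pd (i j k l : Fin 4) :=
    (hg.hasParityOn_christoffel hs j k l).pd hs i
  have parity_mul (i j k e : Fin 4) :
      HasParityOn s (reflSign a * reflSign i * reflSign j * reflSign k)
        fun x => christoffel g a i e x * christoffel g e j k x :=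
    ((hg.hasParityOn_christoffel hs a i e).mul (hg.hasParityOn_christoffel hs e j k)).of_sign_eq
      (by linear_combination reflSign a * reflSign i * reflSign j * reflSign k
        * reflSign_mul_self e)
  refine (((parity_pd c a d b).of_sign_eq (by ring)).sub
    ((parity_pd d a c b).of_sign_eq (by ring))).add (.sum fun e =>
      ((parity_mul c d b e).of_sign_eq (by ring)).sub ((parity_mul d c b e).of_sign_eq (by ring)))

lemma hasParityOn_riemannDown (hg : ReflectionInvariantOn s g) (hs : IsOpen s)
    (a b c d : Fin 4) :
    HasParityOn s (reflSign a * reflSign b * reflSign c * reflSign d)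
      (riemannDown g a b c d) :=
  .sum fun e => ((hg a e).mul (hg.hasParityOn_riemann hs e b c d)).of_sign_eq (by
    linear_combination reflSign a * reflSign b * reflSign c * reflSign d * reflSign_mul_self e)

lemma hasParityOn_riemannUpUp (hg : ReflectionInvariantOn s g) (hs : IsOpen s)
    (a b c d : Fin 4) :
    HasParityOn s (reflSign a * reflSign b * reflSign c * reflSign d)
      (riemannUpUp g a b c d) :=
  .sum fun e => ((hg.inv b e).mul (hg.hasParityOn_riemann hs a e c d)).of_sign_eq (by
    linear_combination reflSign a * reflSign b * reflSign c * reflSign d * reflSign_mul_self e)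

end ReflectionInvariantOn

-- The symbol is the determinant of a `0`-`1` matrix `P`; scaling rows by the signs of `a, b, c, d`
-- is the same as scaling columns by `reflSign`, whose product is `-1`.
lemma reflSign_mul_leviCivitaSymbol (a b c d : Fin 4) :
    reflSign a * reflSign b * reflSign c * reflSign d * leviCivitaSymbol a b c d
      = -leviCivitaSymbol a b c d := by
  set P : Matrix (Fin 4) (Fin 4) ℝ := fun i j => if ![a, b, c, d] i = j then 1 else 0 with hP
  have diagonal_mul_comm : Matrix.diagonal (fun i => reflSign (![a, b, c, d] i)) * P
      = P * Matrix.diagonal reflSign := by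
    ext i j
    rw [Matrix.mul_diagonal, Matrix.diagonal_mul, hP]
    by_cases hij : ![a, b, c, d] i = j <;> simp [hij]
  have det_eq := congrArg Matrix.det diagonal_mul_comm
  rw [Matrix.det_mul, Matrix.det_mul, Matrix.det_diagonal, Matrix.det_diagonal, prod_reflSign,
    Fin.prod_univ_four] at det_eq
  simpa [leviCivitaSymbol] using det_eq

namespace ReflectionInvariantOn

variable {s : Set (Fin 4 → ℝ)} {g : (Fin 4 → ℝ) → Matrix (Fin 4) (Fin 4) ℝ}

lemma hasParityOn_leviCivitaTensor (hg : ReflectionInvariantOn s g) (a b c d : Fin 4) :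
    HasParityOn s (-(reflSign a * reflSign b * reflSign c * reflSign d))
      (leviCivitaTensor g a b c d) := fun x hx => by
  rw [leviCivitaTensor, leviCivitaTensor, hg.volDensity_reflect hx]
  linear_combination -(1 / volDensity g x) * reflSign_mul_leviCivitaSymbol a b c d

lemma hasParityOn_dualRiemann (hg : ReflectionInvariantOn s g) (hs : IsOpen s)
    (a b c d : Fin 4) :
    HasParityOn s (-(reflSign a * reflSign b * reflSign c * reflSign d))
      (dualRiemann g a b c d) :=
  .const_mul _ (.sum fun e => .sum fun f =>
    ((hg.hasParityOn_leviCivitaTensor c d e f).mul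
      (hg.hasParityOn_riemannUpUp hs a b e f)).of_sign_eq (by
        linear_combination -(reflSign a * reflSign b * reflSign c * reflSign d)
          * (reflSign f * reflSign f * reflSign_mul_self e + reflSign_mul_self f)))

lemma hasParityOn_pontryagin (hg : ReflectionInvariantOn s g) (hs : IsOpen s) :
    HasParityOn s (-1) (pontryagin g) := by
  refine .sum fun a => .sum fun b => .sum fun c => .sum fun d =>
    ((hg.hasParityOn_riemannDown hs b a c d).mul
      (hg.hasParityOn_dualRiemann hs a b c d)).of_sign_eq ?_
  calc reflSign b * reflSign a * reflSign c * reflSign d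
        * -(reflSign a * reflSign b * reflSign c * reflSign d)
      = -((reflSign a * reflSign a) * (reflSign b * reflSign b) * (reflSign c * reflSign c)
        * (reflSign d * reflSign d)) := by ring
    _ = -1 := by simp only [reflSign_mul_self, mul_one]

end ReflectionInvariantOn

/-! ## Smooth functions of the radius and the polar angle -/

/-- The derivative of a function of `(r, θ)` in the direction `v`; `∂r` and `∂θ` abbreviate the
partial derivatives. -/
noncomputable def polarDeriv (v : ℝ × ℝ) (H : ℝ × ℝ → ℝ) (p : ℝ × ℝ) : ℝ := fderiv ℝ H p v

local notation "∂r" => polarDeriv (1, 0)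
local notation "∂θ" => polarDeriv (0, 1)

/-- `H` is smooth in a full neighbourhood of each point of `s`, so that derivatives of `H` make
sense on the boundary of `s`. -/
def SmoothNear (s : Set (ℝ × ℝ)) (H : ℝ × ℝ → ℝ) : Prop := ∀ p ∈ s, ContDiffAt ℝ ∞ H p

/-- The points `(r, θ)` outside the horizon. -/
def outside (rH : ℝ) : Set (ℝ × ℝ) := Prod.fst ⁻¹' Ioi rH

/-- The points `(r, θ)` outside or on the horizon. -/
def outsideOrOn (rH : ℝ) : Set (ℝ × ℝ) := Prod.fst ⁻¹' Ici rH

/-- `F` is a smooth extension of `H` to the horizon `r = rH`. -/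
structure IsHorizonExtension (rH : ℝ) (F H : ℝ × ℝ → ℝ) : Prop where
  smooth : SmoothNear (outsideOrOn rH) F
  eqOn : EqOn F H (outside rH)

section PolarDeriv

variable {H K : ℝ × ℝ → ℝ} {p : ℝ × ℝ} (v : ℝ × ℝ)

lemma polarDeriv_congr (h : H =ᶠ[𝓝 p] K) : polarDeriv v H p = polarDeriv v K p := by
  rw [polarDeriv, polarDeriv, h.fderiv_eq]

lemma polarDeriv_mul (hH : DifferentiableAt ℝ H p) (hK : DifferentiableAt ℝ K p) :
    polarDeriv v (fun q => H q * K q) p = H p * polarDeriv v K p + K p * polarDeriv v H p := by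
  simp [polarDeriv, fderiv_fun_mul hH hK]

lemma polarDeriv_add (hH : DifferentiableAt ℝ H p) (hK : DifferentiableAt ℝ K p) :
    polarDeriv v (fun q => H q + K q) p = polarDeriv v H p + polarDeriv v K p := by
  simp [polarDeriv, fderiv_fun_add hH hK]

lemma polarDeriv_sub (hH : DifferentiableAt ℝ H p) (hK : DifferentiableAt ℝ K p) :
    polarDeriv v (fun q => H q - K q) p = polarDeriv v H p - polarDeriv v K p := by
  simp [polarDeriv, fderiv_fun_sub hH hK]

lemma polarDeriv_inv (hH : DifferentiableAt ℝ H p) (hp : H p ≠ 0) :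
    polarDeriv v (fun q => (H q)⁻¹) p = -((H p)⁻¹ * (H p)⁻¹) * polarDeriv v H p := by
  have hinv := ((hasDerivAt_inv hp).comp_hasFDerivAt p hH.hasFDerivAt).fderiv
  have hpow : (H p ^ 2)⁻¹ = (H p)⁻¹ * (H p)⁻¹ := by rw [pow_two, mul_inv]
  rw [polarDeriv, show (fun q => (H q)⁻¹) = Inv.inv ∘ H from rfl, hinv, hpow]
  rfl

end PolarDeriv

lemma pd_comp_polar {H : ℝ × ℝ → ℝ} {x : Fin 4 → ℝ} (hH : DifferentiableAt ℝ H (x 1, x 2))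
    (i : Fin 4) :
    pd i (fun y => H (y 1, y 2)) x = (![0, ∂r H (x 1, x 2), ∂θ H (x 1, x 2), 0] : Fin 4 → ℝ) i := by
  let polar : (Fin 4 → ℝ) →L[ℝ] ℝ × ℝ :=
    (ContinuousLinearMap.proj 1).prod (ContinuousLinearMap.proj 2)
  have chain : HasFDerivAt (fun y : Fin 4 → ℝ => H (y 1, y 2))
      ((fderiv ℝ H (x 1, x 2)).comp polar) x :=
    HasFDerivAt.comp (g := H) x hH.hasFDerivAt polar.hasFDerivAt
  have polar_single : polar (Pi.single i 1)
      = (![0, (1, 0), (0, 1), 0] : Fin 4 → ℝ × ℝ) i := by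
    fin_cases i <;> simp [polar]
  rw [pd, chain.fderiv, ContinuousLinearMap.comp_apply, polar_single]
  fin_cases i <;> simp [polarDeriv]

lemma isOpen_outside (rH : ℝ) : IsOpen (outside rH) := isOpen_Ioi.preimage continuous_fst

lemma polarDeriv_eqOn_of_eqOn {a : ℝ} {H K : ℝ × ℝ → ℝ} (v : ℝ × ℝ)
    (h : EqOn H K (outside a)) : EqOn (polarDeriv v H) (polarDeriv v K) (outside a) :=
  fun _ hp => polarDeriv_congr v (h.eventuallyEq_of_mem ((isOpen_outside a).mem_nhds hp))

lemma outside_subset_outsideOrOn (rH : ℝ) : outside rH ⊆ outsideOrOn rH :=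
  preimage_mono Ioi_subset_Ici_self

namespace SmoothNear

variable {s t : Set (ℝ × ℝ)} {H K : ℝ × ℝ → ℝ}

lemma mono (hH : SmoothNear t H) (hst : s ⊆ t) : SmoothNear s H := fun p hp => hH p (hst hp)

lemma congr (hH : SmoothNear s H) (hs : IsOpen s) (h : EqOn K H s) : SmoothNear s K :=
  fun p hp => (hH p hp).congr_of_eventuallyEq (h.eventuallyEq_of_mem (hs.mem_nhds hp))

lemma mul (hH : SmoothNear s H) (hK : SmoothNear s K) : SmoothNear s fun p => H p * K p :=
  fun p hp => (hH p hp).mul (hK p hp)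

lemma sub (hH : SmoothNear s H) (hK : SmoothNear s K) : SmoothNear s fun p => H p - K p :=
  fun p hp => (hH p hp).sub (hK p hp)

lemma polarDeriv (hH : SmoothNear s H) (v : ℝ × ℝ) : SmoothNear s (polarDeriv v H) :=
  fun p hp => ((hH p hp).fderiv_right (m := ∞) le_rfl).clm_apply contDiffAt_const

lemma differentiableAt (hH : SmoothNear s H) {p : ℝ × ℝ} (hp : p ∈ s) :
    DifferentiableAt ℝ H p :=
  (hH p hp).differentiableAt (by simp)

lemma continuousOn (hH : SmoothNear s H) : ContinuousOn H s :=
  fun p hp => (hH p hp).continuousAt.continuousWithinAt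

end SmoothNear

lemma smoothNear_of_contDiff {H : ℝ × ℝ → ℝ} (hH : ContDiff ℝ ∞ H) (s : Set (ℝ × ℝ)) :
    SmoothNear s H := fun _ _ => hH.contDiffAt

lemma smoothNear_sin (s : Set (ℝ × ℝ)) : SmoothNear s fun p => Real.sin p.2 :=
  smoothNear_of_contDiff (Real.contDiff_sin.comp contDiff_snd) s

namespace IsHorizonExtension

variable {rH : ℝ} {F H : ℝ × ℝ → ℝ}

lemma smoothNear (h : IsHorizonExtension rH F H) : SmoothNear (outside rH) H :=
  (h.smooth.mono (outside_subset_outsideOrOn rH)).congr (isOpen_outside rH) h.eqOn.symm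

lemma polarDeriv_eqOn (h : IsHorizonExtension rH F H) (v : ℝ × ℝ) :
    EqOn (polarDeriv v F) (polarDeriv v H) (outside rH) :=
  polarDeriv_eqOn_of_eqOn v h.eqOn

lemma polarDeriv (h : IsHorizonExtension rH F H) (v : ℝ × ℝ) :
    IsHorizonExtension rH (polarDeriv v F) (polarDeriv v H) :=
  ⟨h.smooth.polarDeriv v, h.polarDeriv_eqOn v⟩

lemma mul (h : IsHorizonExtension rH F H) {F' H' : ℝ × ℝ → ℝ}
    (h' : IsHorizonExtension rH F' H') :
    IsHorizonExtension rH (fun p => F p * F' p) fun p => H p * H' p :=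
  ⟨h.smooth.mul h'.smooth, fun p hp => by simp only [h.eqOn hp, h'.eqOn hp]⟩

end IsHorizonExtension

lemma isHorizonExtension_sin (rH : ℝ) :
    IsHorizonExtension rH (fun p => Real.sin p.2) fun p => Real.sin p.2 :=
  ⟨smoothNear_sin _, fun _ _ => rfl⟩

lemma ExtendsSmoothly.exists_isHorizonExtension {rH : ℝ} {f : ℝ → ℝ → ℝ} {b : ℝ → ℝ}
    (h : ExtendsSmoothly rH f b) :
    ∃ F, IsHorizonExtension rH F (Function.uncurry f) ∧ ∀ θ, F (rH, θ) = b θ :=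
  let ⟨F, hF, hFf, hFb⟩ := h
  ⟨F, ⟨smoothNear_of_contDiff hF _, fun p hp => hFf p.1 p.2 hp⟩, hFb⟩

lemma ExtendsSmoothly.smoothNear {rH : ℝ} {f : ℝ → ℝ → ℝ} {b : ℝ → ℝ}
    (h : ExtendsSmoothly rH f b) : SmoothNear (outside rH) (Function.uncurry f) :=
  let ⟨_, hF, _⟩ := h.exists_isHorizonExtension
  hF.smoothNear

/-! ## Operators in divergence form and Green's identity -/

/-- The divergence-form operator `U ↦ ∂_r (P sin θ ∂_r U) + ∂_θ (Q sin θ ∂_θ U)`. -/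
noncomputable def divGrad (P Q U : ℝ × ℝ → ℝ) (p : ℝ × ℝ) : ℝ :=
  ∂r (fun q => P q * Real.sin q.2 * ∂r U q) p + ∂θ (fun q => Q q * Real.sin q.2 * ∂θ U q) p

/-- The antisymmetric expression `V ∂_v U - U ∂_v V`. -/
noncomputable def wronskian (v : ℝ × ℝ) (V U : ℝ × ℝ → ℝ) (p : ℝ × ℝ) : ℝ :=
  V p * polarDeriv v U p - U p * polarDeriv v V p

section Green

variable {s : Set (ℝ × ℝ)} {P Q U V : ℝ × ℝ → ℝ}

lemma IsHorizonExtension.divGrad {rH : ℝ} {P' Q' U' : ℝ × ℝ → ℝ}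
    (hP : IsHorizonExtension rH P P') (hQ : IsHorizonExtension rH Q Q')
    (hU : IsHorizonExtension rH U U') :
    IsHorizonExtension rH (divGrad P Q U) (divGrad P' Q' U') := by
  have hr := ((hP.mul (isHorizonExtension_sin rH)).mul (hU.polarDeriv (1, 0))).polarDeriv (1, 0)
  have hθ := ((hQ.mul (isHorizonExtension_sin rH)).mul (hU.polarDeriv (0, 1))).polarDeriv (0, 1)
  exact ⟨fun p hp => (hr.smooth p hp).add (hθ.smooth p hp),
    fun p hp => congrArg₂ (· + ·) (hr.eqOn hp) (hθ.eqOn hp)⟩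

lemma SmoothNear.wronskian (hV : SmoothNear s V) (hU : SmoothNear s U) (v : ℝ × ℝ) :
    SmoothNear s (wronskian v V U) :=
  (hV.mul (hU.polarDeriv v)).sub (hU.mul (hV.polarDeriv v))

lemma polarDeriv_mul_wronskian {C : ℝ × ℝ → ℝ} (hC : SmoothNear s C) (hU : SmoothNear s U)
    (hV : SmoothNear s V) (v : ℝ × ℝ) {p : ℝ × ℝ} (hp : p ∈ s) :
    polarDeriv v (fun q => C q * wronskian v V U q) p
      = V p * polarDeriv v (fun q => C q * polarDeriv v U q) p
        - U p * polarDeriv v (fun q => C q * polarDeriv v V q) p := by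
  have hCU := hC.mul (hU.polarDeriv v)
  have hCV := hC.mul (hV.polarDeriv v)
  have distrib : (fun q => C q * wronskian v V U q)
      = fun q => V q * (C q * polarDeriv v U q) - U q * (C q * polarDeriv v V q) := by
    funext q; rw [wronskian]; ring
  rw [distrib, polarDeriv_sub v ((hV.mul hCU).differentiableAt hp)
      ((hU.mul hCV).differentiableAt hp),
    polarDeriv_mul v (hV.differentiableAt hp) (hCU.differentiableAt hp),
    polarDeriv_mul v (hU.differentiableAt hp) (hCV.differentiableAt hp)]
  ring

lemma mul_divGrad_sub_mul_divGrad (hP : SmoothNear s P) (hQ : SmoothNear s Q)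
    (hU : SmoothNear s U) (hV : SmoothNear s V) {p : ℝ × ℝ} (hp : p ∈ s) :
    V p * divGrad P Q U p - U p * divGrad P Q V p
      = ∂r (fun q => P q * Real.sin q.2 * wronskian (1, 0) V U q) p
        + ∂θ (fun q => Q q * Real.sin q.2 * wronskian (0, 1) V U q) p := by
  rw [polarDeriv_mul_wronskian (hP.mul (smoothNear_sin s)) hU hV _ hp,
    polarDeriv_mul_wronskian (hQ.mul (smoothNear_sin s)) hU hV _ hp, divGrad, divGrad]
  ring

lemma integral_divergence_of_boundary_eq_zero {a R : ℝ} (haR : a ≤ R) {f g : ℝ × ℝ → ℝ}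
    (hf : SmoothNear (outsideOrOn a) f) (hg : SmoothNear (outsideOrOn a) g)
    (hfa : ∀ θ, f (a, θ) = 0) (hg_zero : ∀ r, g (r, 0) = 0) (hg_pi : ∀ r, g (r, π) = 0) :
    ∫ r in a..R, ∫ θ in (0 : ℝ)..π, (∂r f (r, θ) + ∂θ g (r, θ)) = ∫ θ in (0 : ℝ)..π, f (R, θ) := by
  have uIcc_subset : uIcc a R ×ˢ uIcc 0 π ⊆ outsideOrOn a := fun p hp =>
    (uIcc_of_le haR ▸ hp.1 : p.1 ∈ Icc a R).1
  have Ioo_subset : Ioo (min a R) (max a R) ×ˢ Ioo (min 0 π) (max 0 π) ⊆ outsideOrOn a :=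
    (Set.prod_mono Ioo_subset_Icc_self Ioo_subset_Icc_self).trans uIcc_subset
  have divergence_continuousOn :
      ContinuousOn (fun p => ∂r f p + ∂θ g p) (uIcc a R ×ˢ uIcc 0 π) :=
    ((hf.polarDeriv _).continuousOn.add (hg.polarDeriv _).continuousOn).mono uIcc_subset
  have divergence := integral2_divergence_prod_of_hasFDerivAt_off_countable f g
    (fderiv ℝ f) (fderiv ℝ g) a 0 R π ∅ countable_empty
    (hf.continuousOn.mono uIcc_subset) (hg.continuousOn.mono uIcc_subset)
    (fun p hp => (hf.differentiableAt (Ioo_subset hp.1)).hasFDerivAt)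
    (fun p hp => (hg.differentiableAt (Ioo_subset hp.1)).hasFDerivAt)
    (divergence_continuousOn.integrableOn_compact (isCompact_uIcc.prod isCompact_uIcc))
  simpa only [polarDeriv, hfa, hg_zero, hg_pi, intervalIntegral.integral_zero, sub_zero,
    zero_add] using divergence

lemma green_identity {a R : ℝ} (haR : a ≤ R) (hP : SmoothNear (outsideOrOn a) P)
    (hQ : SmoothNear (outsideOrOn a) Q) (hU : SmoothNear (outsideOrOn a) U)
    (hV : SmoothNear (outsideOrOn a) V) (hPa : ∀ θ, P (a, θ) = 0) :
    ∫ r in a..R, ∫ θ in (0 : ℝ)..π,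
      (V (r, θ) * divGrad P Q U (r, θ) - U (r, θ) * divGrad P Q V (r, θ))
    = ∫ θ in (0 : ℝ)..π, P (R, θ) * Real.sin θ * wronskian (1, 0) V U (R, θ) := by
  rw [← integral_divergence_of_boundary_eq_zero haR
    (f := fun q => P q * Real.sin q.2 * wronskian (1, 0) V U q)
    (g := fun q => Q q * Real.sin q.2 * wronskian (0, 1) V U q)
    ((hP.mul (smoothNear_sin _)).mul (hV.wronskian hU _))
    ((hQ.mul (smoothNear_sin _)).mul (hV.wronskian hU _)) (by simp [hPa]) (by simp) (by simp)]
  refine intervalIntegral.integral_congr fun r hr =>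
    intervalIntegral.integral_congr fun θ _ => ?_
  rw [uIcc_of_le haR] at hr
  exact mul_divGrad_sub_mul_divGrad hP hQ hU hV (p := (r, θ)) hr.1

end Green

/-! ## The wave operator outside a regular horizon -/

/-- The region outside a nondegenerate null hypersurface `r = rH` of an equatorially symmetric
metric: an `IsBlackHole` that may be singular on the axis and whose horizon may rotate
differentially. -/
structure IsRegularExterior (m : HTMetric) (rH : ℝ) : Prop where
  rH_pos : 0 < rH
  pos : ∀ r θ, rH < r → 0 < m.N r θ ∧ 0 < m.A r θ ∧ 0 < m.B r θ
  reflection : ∀ r θ, rH < r →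
    m.N r (π - θ) = m.N r θ ∧ m.A r (π - θ) = m.A r θ ∧
    m.B r (π - θ) = m.B r θ ∧ m.w r (π - θ) = m.w r θ
  horizon_N : ExtendsSmoothly rH (fun r θ => m.N r θ ^ 2) fun _ => 0
  horizon_NA : ∃ b, ExtendsSmoothly rH (fun r θ => m.N r θ * m.A r θ) b ∧ ∀ θ, 0 < b θ
  horizon_B : ∃ b, ExtendsSmoothly rH m.B b ∧ ∀ θ, 0 < b θ
  horizon_w : ∃ b, ExtendsSmoothly rH m.w b

/-- `√(-g) / sin θ`. -/
def HTMetric.volCoeff (m : HTMetric) (p : ℝ × ℝ) : ℝ :=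
  m.N p.1 p.2 * m.A p.1 p.2 * p.1 ^ 2 * m.B p.1 p.2 ^ 2

/-- `√(-g) g^{rr} / sin θ`. -/
noncomputable def HTMetric.radialCoeff (m : HTMetric) (p : ℝ × ℝ) : ℝ :=
  m.N p.1 p.2 * p.1 ^ 2 * m.B p.1 p.2 ^ 2 / m.A p.1 p.2

/-- `√(-g) g^{θθ} / sin θ`. -/
def HTMetric.angularCoeff (m : HTMetric) (p : ℝ × ℝ) : ℝ := m.N p.1 p.2 * m.A p.1 p.2

lemma IsBlackHole.isRegularExterior {m : HTMetric} {rH ΩH : ℝ} (hm : IsBlackHole m rH ΩH) :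
    IsRegularExterior m rH :=
  ⟨hm.rH_pos, hm.pos, hm.reflection, hm.horizon_N, hm.horizon_NA, hm.horizon_B,
    _, hm.horizon_w⟩

lemma isOpen_exterior (rH : ℝ) : IsOpen (exterior rH) :=
  (isOpen_lt continuous_const (continuous_apply 1)).inter
    ((isOpen_lt continuous_const (continuous_apply 2)).inter
      (isOpen_lt (continuous_apply 2) continuous_const))

namespace IsRegularExterior

variable {m : HTMetric} {rH : ℝ}

lemma reflectionInvariantOn (hm : IsRegularExterior m rH) :
    ReflectionInvariantOn (exterior rH) m.g := by
  intro i j x hx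
  obtain ⟨hN, hA, hB, hw⟩ := hm.reflection (x 1) (x 2) hx.1
  have h1 : reflect x 1 = x 1 := reflect_apply_of_ne (by decide) x
  simp only [HTMetric.g, h1, reflect_apply_two, hN, hA, hB, hw, Real.sin_pi_sub]
  fin_cases i <;> fin_cases j <;> simp [reflSign]

lemma volDensity_eq (hm : IsRegularExterior m rH) {x : Fin 4 → ℝ} (hx : x ∈ exterior rH) :
    volDensity m.g x = m.volCoeff (x 1, x 2) * Real.sin (x 2) := by
  obtain ⟨hN, hA, hB⟩ := hm.pos (x 1) (x 2) hx.1
  have hr : 0 < x 1 := hm.rH_pos.trans hx.1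
  have hsin := Real.sin_pos_of_pos_of_lt_pi hx.2.1 hx.2.2
  have det_eq : -(m.g x).det = (m.volCoeff (x 1, x 2) * Real.sin (x 2)) ^ 2 := by
    simp [HTMetric.g, HTMetric.volCoeff, Matrix.det_succ_row_zero, Fin.sum_univ_succ,
      Fin.succAbove]
    ring
  rw [volDensity, det_eq, Real.sqrt_sq (by simp only [HTMetric.volCoeff]; positivity)]

lemma volDensity_pos (hm : IsRegularExterior m rH) {x : Fin 4 → ℝ} (hx : x ∈ exterior rH) :
    0 < volDensity m.g x := by
  obtain ⟨hN, hA, hB⟩ := hm.pos (x 1) (x 2) hx.1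
  have hr : 0 < x 1 := hm.rH_pos.trans hx.1
  have hsin := Real.sin_pos_of_pos_of_lt_pi hx.2.1 hx.2.2
  rw [hm.volDensity_eq hx, HTMetric.volCoeff]
  positivity

lemma inv_g (hm : IsRegularExterior m rH) {x : Fin 4 → ℝ} (hx : x ∈ exterior rH) :
    (m.g x)⁻¹ = !![-1 / m.N (x 1) (x 2) ^ 2, 0, 0, -m.w (x 1) (x 2) / m.N (x 1) (x 2) ^ 2;
      0, 1 / m.A (x 1) (x 2) ^ 2, 0, 0;
      0, 0, 1 / (x 1 ^ 2 * m.B (x 1) (x 2) ^ 2), 0;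
      -m.w (x 1) (x 2) / m.N (x 1) (x 2) ^ 2, 0, 0,
        1 / (x 1 ^ 2 * m.B (x 1) (x 2) ^ 2 * Real.sin (x 2) ^ 2)
          - m.w (x 1) (x 2) ^ 2 / m.N (x 1) (x 2) ^ 2] := by
  obtain ⟨hN, hA, hB⟩ := hm.pos (x 1) (x 2) hx.1
  have hr : x 1 ≠ 0 := (hm.rH_pos.trans hx.1).ne'
  have hsin := (Real.sin_pos_of_pos_of_lt_pi hx.2.1 hx.2.2).ne'
  apply Matrix.inv_eq_right_inv
  ext i j
  fin_cases i <;> fin_cases j <;>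
    simp [HTMetric.g, Matrix.mul_apply, Fin.sum_univ_four] <;> field_simp <;> ring

lemma volDensity_mul_gradient (hm : IsRegularExterior m rH) {f : ℝ → ℝ → ℝ} {x : Fin 4 → ℝ}
    (hx : x ∈ exterior rH) (hf : DifferentiableAt ℝ (Function.uncurry f) (x 1, x 2)) (i : Fin 4) :
    volDensity m.g x * ∑ j, (m.g x)⁻¹ i j * pd j (lift f) x
      = (![0, m.radialCoeff (x 1, x 2) * Real.sin (x 2) * ∂r (Function.uncurry f) (x 1, x 2),
          m.angularCoeff (x 1, x 2) * Real.sin (x 2) * ∂θ (Function.uncurry f) (x 1, x 2), 0] :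
          Fin 4 → ℝ) i := by
  obtain ⟨hN, hA, hB⟩ := hm.pos (x 1) (x 2) hx.1
  have hr : x 1 ≠ 0 := (hm.rH_pos.trans hx.1).ne'
  have pd_lift (j : Fin 4) : pd j (lift f) x = _ := pd_comp_polar hf j
  simp only [pd_lift, hm.volDensity_eq hx, hm.inv_g hx, Fin.sum_univ_four]
  fin_cases i <;>
    simp [HTMetric.volCoeff, HTMetric.radialCoeff, HTMetric.angularCoeff] <;> field_simp

lemma exists_radialCoeff_extension (hm : IsRegularExterior m rH) :
    ∃ P, IsHorizonExtension rH P m.radialCoeff ∧ ∀ θ, P (rH, θ) = 0 := by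
  obtain ⟨F, hF, hF_horizon⟩ := hm.horizon_N.exists_isHorizonExtension
  obtain ⟨b, hNA, hb⟩ := hm.horizon_NA
  obtain ⟨K, hK, hK_horizon⟩ := hNA.exists_isHorizonExtension
  obtain ⟨_, hB, -⟩ := hm.horizon_B
  obtain ⟨L, hL, -⟩ := hB.exists_isHorizonExtension
  have hK_ne (p : ℝ × ℝ) (hp : p ∈ outsideOrOn rH) : K p ≠ 0 := by
    obtain h | h := (show rH ≤ p.1 from hp).lt_or_eq
    · obtain ⟨hN, hA, -⟩ := hm.pos p.1 p.2 h
      rw [hK.eqOn h]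
      exact (mul_pos hN hA).ne'
    · rw [← p.eta, ← h, hK_horizon]
      exact (hb _).ne'
  refine ⟨fun p => F p * p.1 ^ 2 * L p ^ 2 / K p, ⟨fun p hp => ?_, fun p hp => ?_⟩, fun θ => ?_⟩
  · exact (((hF.smooth p hp).mul (contDiff_fst.contDiffAt.pow 2)).mul
      ((hL.smooth p hp).pow 2)).div (hK.smooth p hp) (hK_ne p hp)
  · obtain ⟨hN, hA, -⟩ := hm.pos p.1 p.2 hp
    simp only [hF.eqOn hp, hK.eqOn hp, hL.eqOn hp, Function.uncurry, HTMetric.radialCoeff]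
    field_simp
  · simp [hF_horizon]

lemma exists_angularCoeff_extension (hm : IsRegularExterior m rH) :
    ∃ Q, IsHorizonExtension rH Q m.angularCoeff :=
  let ⟨_, h, _⟩ := hm.horizon_NA
  let ⟨Q, hQ, _⟩ := h.exists_isHorizonExtension
  ⟨Q, hQ⟩

lemma smoothNear_radialCoeff (hm : IsRegularExterior m rH) :
    SmoothNear (outside rH) m.radialCoeff :=
  let ⟨_, hP, _⟩ := hm.exists_radialCoeff_extension
  hP.smoothNear

lemma smoothNear_angularCoeff (hm : IsRegularExterior m rH) :
    SmoothNear (outside rH) m.angularCoeff :=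
  let ⟨_, hQ⟩ := hm.exists_angularCoeff_extension
  hQ.smoothNear

lemma volDensity_mul_box (hm : IsRegularExterior m rH) {f : ℝ → ℝ → ℝ}
    (hf : SmoothNear (outside rH) (Function.uncurry f)) {x : Fin 4 → ℝ} (hx : x ∈ exterior rH) :
    volDensity m.g x * box m.g (lift f) x
      = divGrad m.radialCoeff m.angularCoeff (Function.uncurry f) (x 1, x 2) := by
  have pd_gradient (i : Fin 4) :
      pd i (fun y => volDensity m.g y * ∑ j, (m.g y)⁻¹ i j * pd j (lift f) y) x
        = pd i (fun y => (![0, m.radialCoeff (y 1, y 2) * Real.sin (y 2)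
            * ∂r (Function.uncurry f) (y 1, y 2), m.angularCoeff (y 1, y 2) * Real.sin (y 2)
            * ∂θ (Function.uncurry f) (y 1, y 2), 0] : Fin 4 → ℝ) i) x := by
    rw [pd, pd, EventuallyEq.fderiv_eq]
    filter_upwards [(isOpen_exterior rH).mem_nhds hx] with y hy
    exact hm.volDensity_mul_gradient hy (hf.differentiableAt hy.1) i
  have pd_radial := pd_comp_polar (x := x) (((hm.smoothNear_radialCoeff.mul
    (smoothNear_sin _)).mul (hf.polarDeriv (1, 0))).differentiableAt hx.1) 1
  have pd_angular := pd_comp_polar (x := x) (((hm.smoothNear_angularCoeff.mul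
    (smoothNear_sin _)).mul (hf.polarDeriv (0, 1))).differentiableAt hx.1) 2
  have pd_zero (i : Fin 4) : pd i (fun _ => 0) x = 0 := by simp [pd]
  rw [box, ← mul_assoc, mul_one_div_cancel (hm.volDensity_pos hx).ne', one_mul,
    Fin.sum_univ_four]
  simp only [pd_gradient]
  simpa [pd_zero, divGrad] using congrArg₂ (· + ·) pd_radial pd_angular

end IsRegularExterior

/-! ## The source density and its flux -/

/-- `G (r, θ)` is the density `ε *RR v √(-g)`, continuous up to the horizon. On the axis, where
the metric degenerates, its values are those obtained by continuity. -/
structure IsSourceDensity (m : HTMetric) (rH ε : ℝ) (v : ℝ → ℝ → ℝ) (G : ℝ × ℝ → ℝ) : Prop where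
  continuousOn : ContinuousOn G (outsideOrOn rH)
  eq : ∀ x ∈ exterior rH,
    G (x 1, x 2) = ε * (pontryagin m.g x * lift v x) * volDensity m.g x

/-- The flux of `V ∇U - U ∇V` through the sphere of radius `R`, up to the factor `2π`. -/
noncomputable def HTMetric.wronskianFlux (m : HTMetric) (V U : ℝ × ℝ → ℝ) (R : ℝ) : ℝ :=
  ∫ θ in (0 : ℝ)..π, m.radialCoeff (R, θ) * Real.sin θ * wronskian (1, 0) V U (R, θ)

lemma box_const (g : (Fin 4 → ℝ) → Matrix (Fin 4) (Fin 4) ℝ) (c : ℝ) (x : Fin 4 → ℝ) :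
    box g (lift fun _ _ => c) x = 0 := by
  have pd_const (c : ℝ) (i : Fin 4) (y : Fin 4 → ℝ) : pd i (fun _ => c) y = 0 := by simp [pd]
  have lift_const : (lift fun _ _ => c) = fun _ => c := rfl
  simp only [box, lift_const, pd_const, mul_zero, Finset.sum_const_zero]

lemma extendsSmoothly_const (rH c : ℝ) : ExtendsSmoothly rH (fun _ _ => c) fun _ => c :=
  ⟨fun _ => c, contDiff_const, fun _ _ _ => rfl, fun _ => rfl⟩

section SourceDensity

variable {m : HTMetric} {rH ε : ℝ} {v Φ : ℝ → ℝ → ℝ} {G : ℝ × ℝ → ℝ}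

/-- The two boundary terms besides the one at `R` vanish: `√(-g) g^{rr}` on the horizon, `sin θ` on
the axis. -/
lemma exists_isSourceDensity (hm : IsRegularExterior m rH) (hΦ : ∃ b, ExtendsSmoothly rH Φ b)
    (heq : SolvesDCS m rH ε Φ) (hv : ∃ b, ExtendsSmoothly rH v b)
    (hbox : ∀ x ∈ exterior rH, box m.g (lift v) x = 0) :
    ∃ G, IsSourceDensity m rH ε v G ∧ ∀ R, rH < R → ∫ r in rH..R, ∫ θ in (0 : ℝ)..π, G (r, θ)
      = -m.wronskianFlux (Function.uncurry v) (Function.uncurry Φ) R := by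
  obtain ⟨_, hΦ⟩ := hΦ
  obtain ⟨_, hv⟩ := hv
  obtain ⟨U, hU, -⟩ := hΦ.exists_isHorizonExtension
  obtain ⟨V, hV, -⟩ := hv.exists_isHorizonExtension
  obtain ⟨P, hP, hP_horizon⟩ := hm.exists_radialCoeff_extension
  obtain ⟨Q, hQ⟩ := hm.exists_angularCoeff_extension
  have hVU := hV.mul (hP.divGrad hQ hU)
  have hUV := hU.mul (hP.divGrad hQ hV)
  refine ⟨fun p => -(V p * divGrad P Q U p - U p * divGrad P Q V p),
    ⟨(hVU.smooth.sub hUV.smooth).continuousOn.neg, fun x hx => ?_⟩, fun R hR => ?_⟩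
  · have hp : (x 1, x 2) ∈ outside rH := hx.1
    have box_Φ := hm.volDensity_mul_box hΦ.smoothNear hx
    have box_v := hm.volDensity_mul_box hv.smoothNear hx
    rw [hbox x hx, mul_zero] at box_v
    simp only [hVU.eqOn hp, hUV.eqOn hp, ← box_Φ, ← box_v, lift, Function.uncurry]
    linear_combination (-v (x 1) (x 2) * volDensity m.g x) * heq x hx
  · simp only [intervalIntegral.integral_neg, HTMetric.wronskianFlux]
    rw [green_identity hR.le hP.smooth hQ.smooth hU.smooth hV.smooth hP_horizon]
    refine congrArg Neg.neg (intervalIntegral.integral_congr fun θ _ => ?_)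
    have hp : (R, θ) ∈ outside rH := hR
    simp only [wronskian, hP.eqOn hp, hU.eqOn hp, hV.eqOn hp, hU.polarDeriv_eqOn _ hp,
      hV.polarDeriv_eqOn _ hp]

lemma IsSourceDensity.apply_pi_sub (hG : IsSourceDensity m rH ε v G)
    (hm : IsRegularExterior m rH) {r θ : ℝ} (hr : rH < r) (hθ : θ ∈ Ioo 0 π)
    (hv : v r (π - θ) = v r θ) : G (r, π - θ) = -G (r, θ) := by
  set x : Fin 4 → ℝ := ![0, r, θ, 0] with x_def
  have hx : x ∈ exterior rH := ⟨hr, hθ.1, hθ.2⟩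
  have reflect_x : reflect x = ![0, r, π - θ, 0] := by
    ext i; fin_cases i <;> simp [x_def, reflect_apply_two, reflect_apply_of_ne]
  have hx' : reflect x ∈ exterior rH :=
    reflect_x ▸ ⟨hr, sub_pos.2 hθ.2, sub_lt_self _ hθ.1⟩
  have G_eq := hG.eq _ hx
  have G_reflect := hG.eq _ hx'
  rw [hm.reflectionInvariantOn.volDensity_reflect hx,
    hm.reflectionInvariantOn.hasParityOn_pontryagin (isOpen_exterior rH) x hx,
    reflect_x] at G_reflect
  simp only [x_def, Matrix.cons_val, lift] at G_eq G_reflect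
  rw [G_eq, G_reflect, hv]
  ring

lemma IsSourceDensity.integral_eq_zero (hG : IsSourceDensity m rH ε v G)
    (hm : IsRegularExterior m rH) {r : ℝ} (hr : rH < r) (hv : ∀ θ, v r (π - θ) = v r θ) :
    ∫ θ in (0 : ℝ)..π, G (r, θ) = 0 := by
  have integral_reflect := intervalIntegral.integral_comp_sub_left (a := 0) (b := π)
    (fun θ => G (r, θ)) π
  rw [intervalIntegral.integral_congr_Ioo_of_le Real.pi_pos.le
      fun θ hθ => hG.apply_pi_sub hm hr hθ (hv θ),
    intervalIntegral.integral_neg, sub_self, sub_zero] at integral_reflect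
  linarith

lemma wronskianFlux_one_eq_zero (hm : IsRegularExterior m rH)
    (hΦ : ∃ b, ExtendsSmoothly rH Φ b) (heq : SolvesDCS m rH ε Φ) {R : ℝ} (hR : rH < R) :
    m.wronskianFlux (fun _ => 1) (Function.uncurry Φ) R = 0 := by
  obtain ⟨G, hG, hflux⟩ := exists_isSourceDensity hm hΦ heq ⟨_, extendsSmoothly_const rH 1⟩
    fun x _ => box_const m.g 1 x
  have flux_zero := hflux R hR
  rw [intervalIntegral.integral_congr_Ioo_of_le (g := fun _ => 0) hR.le
    fun r hr => hG.integral_eq_zero hm hr.1 fun _ => rfl,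
    intervalIntegral.integral_zero] at flux_zero
  exact neg_eq_zero.1 flux_zero.symm

end SourceDensity

/-! ## Leading terms at radial infinity -/

/-- The filter of `r → ∞`, uniformly in `θ`. -/
def radialInfinity : Filter (ℝ × ℝ) := atTop ×ˢ ⊤

/-- `H = c(θ) r^n + o(r^n)` as `r → ∞`, uniformly in `θ`. The coefficient is bounded but may
vanish, so that `HasLeadingTerm n 0 H` says `H = o(r^n)`. -/
structure HasLeadingTerm (n : ℤ) (c : ℝ → ℝ) (H : ℝ × ℝ → ℝ) : Prop where
  bounded : ∃ C, ∀ θ, |c θ| ≤ C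
  tendsto : Tendsto (fun p => p.1 ^ (-n) * H p - c p.2) radialInfinity (𝓝 0)

lemma eventually_outside (a : ℝ) : ∀ᶠ p in radialInfinity, p ∈ outside a :=
  (eventually_gt_atTop a).prod_inl _

lemma tendsto_zpow_radialInfinity {n : ℤ} (hn : n < 0) :
    Tendsto (fun p : ℝ × ℝ => p.1 ^ n) radialInfinity (𝓝 0) :=
  (tendsto_zpow_atTop_zero hn).comp tendsto_fst

lemma tendsto_bounded_mul {c : ℝ → ℝ} (hc : ∃ C, ∀ θ, |c θ| ≤ C) {F : ℝ × ℝ → ℝ}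
    (hF : Tendsto F radialInfinity (𝓝 0)) :
    Tendsto (fun p => c p.2 * F p) radialInfinity (𝓝 0) :=
  let ⟨C, hC⟩ := hc
  bdd_le_mul_tendsto_zero' C (.of_forall fun p => hC p.2) hF

namespace HasLeadingTerm

variable {n k : ℤ} {c d : ℝ → ℝ} {H K : ℝ × ℝ → ℝ}

lemma congr (hH : HasLeadingTerm n c H) (hn : n = k) (hc : ∀ θ, c θ = d θ)
    (hHK : H =ᶠ[radialInfinity] K) : HasLeadingTerm k d K := by
  obtain rfl : c = d := funext hc
  subst hn
  exact ⟨hH.bounded, hH.tendsto.congr' (hHK.mono fun p hp => by rw [hp])⟩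

lemma add (hH : HasLeadingTerm n c H) (hK : HasLeadingTerm n d K) :
    HasLeadingTerm n (fun θ => c θ + d θ) fun p => H p + K p := by
  obtain ⟨C, hC⟩ := hH.bounded
  obtain ⟨D, hD⟩ := hK.bounded
  refine ⟨⟨C + D, fun θ => (abs_add_le _ _).trans (add_le_add (hC θ) (hD θ))⟩, ?_⟩
  simpa only [add_zero, mul_add, add_sub_add_comm] using hH.tendsto.add hK.tendsto

lemma mul (hH : HasLeadingTerm n c H) (hK : HasLeadingTerm k d K) :
    HasLeadingTerm (n + k) (fun θ => c θ * d θ) fun p => H p * K p := by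
  obtain ⟨C, hC⟩ := hH.bounded
  obtain ⟨D, hD⟩ := hK.bounded
  refine ⟨⟨C * D, fun θ => (abs_mul _ _).trans_le
    (mul_le_mul (hC θ) (hD θ) (abs_nonneg _) ((abs_nonneg _).trans (hC θ)))⟩, ?_⟩
  have hsum := ((hH.tendsto.mul hK.tendsto).add (tendsto_bounded_mul hH.bounded hK.tendsto)).add
    (tendsto_bounded_mul hK.bounded hH.tendsto)
  simp only [mul_zero, add_zero] at hsum
  refine hsum.congr' ((eventually_outside 0).mono fun p hp => ?_)
  have hr : p.1 ≠ 0 := ne_of_gt hp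
  simp only [neg_add, zpow_add₀ hr]
  ring

lemma of_lt (hH : HasLeadingTerm n c H) (hnk : n < k) : HasLeadingTerm k (fun _ => 0) H := by
  refine ⟨⟨0, by simp⟩, ?_⟩
  have hpow := tendsto_zpow_radialInfinity (n := n - k) (by omega)
  have hsum := (hpow.mul hH.tendsto).add (tendsto_bounded_mul hH.bounded hpow)
  simp only [mul_zero, add_zero] at hsum
  refine hsum.congr' ((eventually_outside 0).mono fun p hp => ?_)
  have hr : p.1 ≠ 0 := ne_of_gt hp
  simp only [show -k = (n - k) + -n by ring, zpow_add₀ hr]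
  ring

lemma inv {a : ℝ} (ha : a ≠ 0) (hH : HasLeadingTerm n (fun _ => a) H) :
    HasLeadingTerm (-n) (fun _ => a⁻¹) fun p => (H p)⁻¹ := by
  refine ⟨⟨_, fun _ => le_rfl⟩, tendsto_sub_nhds_zero_iff.2 ?_⟩
  refine ((tendsto_sub_nhds_zero_iff.1 hH.tendsto).inv₀ ha).congr fun p => ?_
  rw [mul_inv, zpow_neg, inv_inv, neg_neg]

lemma tendsto_ray (hH : HasLeadingTerm n c H) (θ : ℝ) :
    Tendsto (fun r : ℝ => r ^ (-n) * H (r, θ)) atTop (𝓝 (c θ)) :=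
  tendsto_sub_nhds_zero_iff.1 (hH.tendsto.comp (tendsto_id.prodMk tendsto_top))

end HasLeadingTerm

lemma hasLeadingTerm_angular {c : ℝ → ℝ} (hc : ∃ C, ∀ θ, |c θ| ≤ C) :
    HasLeadingTerm 0 c fun p => c p.2 :=
  ⟨hc, by simpa using tendsto_const_nhds⟩

/-- The function `c(θ) r^n`. -/
noncomputable def radialMonomial (n : ℤ) (c : ℝ → ℝ) (p : ℝ × ℝ) : ℝ := c p.2 * p.1 ^ n

lemma hasLeadingTerm_radialMonomial (n : ℤ) {c : ℝ → ℝ} (hc : ∃ C, ∀ θ, |c θ| ≤ C) :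
    HasLeadingTerm n c (radialMonomial n c) := by
  refine ⟨hc, tendsto_const_nhds.congr' ((eventually_outside 0).mono fun p hp => ?_)⟩
  have hr : p.1 ^ n ≠ 0 := zpow_ne_zero n (ne_of_gt hp)
  simp only [radialMonomial, zpow_neg]
  field_simp
  simp

/-- `HasLeadingTerm` with termwise differentiation. -/
structure HasLeadingTermC1 (n : ℤ) (c : ℝ → ℝ) (H : ℝ × ℝ → ℝ) : Prop where
  differentiable_coeff : Differentiable ℝ c
  differentiableAt : ∀ᶠ p in radialInfinity, DifferentiableAt ℝ H p
  value : HasLeadingTerm n c H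
  radial : HasLeadingTerm (n - 1) (fun θ => n * c θ) (∂r H)
  angular : HasLeadingTerm n (deriv c) (∂θ H)

/-- `HasLeadingTerm` with termwise differentiation up to twice, mixed derivatives excluded. -/
structure HasLeadingTermC2 (n : ℤ) (c : ℝ → ℝ) (H : ℝ × ℝ → ℝ) : Prop
    extends HasLeadingTermC1 n c H where
  radial_radial : HasLeadingTerm (n - 2) (fun θ => n * (n - 1) * c θ) (∂r (∂r H))
  angular_angular : HasLeadingTerm n (deriv (deriv c)) (∂θ (∂θ H))

namespace HasLeadingTermC1

variable {n k : ℤ} {c d : ℝ → ℝ} {H K : ℝ × ℝ → ℝ}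

lemma mul (hH : HasLeadingTermC1 n c H) (hK : HasLeadingTermC1 k d K) :
    HasLeadingTermC1 (n + k) (fun θ => c θ * d θ) fun p => H p * K p := by
  have polarDeriv_eq (v : ℝ × ℝ) : (fun p => H p * polarDeriv v K p + K p * polarDeriv v H p)
      =ᶠ[radialInfinity] polarDeriv v fun p => H p * K p := by
    filter_upwards [hH.differentiableAt, hK.differentiableAt] with p hHp hKp
    exact (polarDeriv_mul v hHp hKp).symm
  have hradial := ((hH.value.mul hK.radial).congr (k := n + k - 1) (by ring) (fun _ => rfl)
    .rfl).add ((hK.value.mul hH.radial).congr (by ring) (fun _ => rfl) .rfl)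
  have hangular := (hH.value.mul hK.angular).add
    ((hK.value.mul hH.angular).congr (add_comm k n) (fun _ => rfl) .rfl)
  refine ⟨hH.differentiable_coeff.mul hK.differentiable_coeff,
    hH.differentiableAt.and hK.differentiableAt |>.mono fun p hp => hp.1.mul hp.2,
    hH.value.mul hK.value, hradial.congr rfl (fun θ => ?_) (polarDeriv_eq _),
    hangular.congr rfl (fun θ => ?_) (polarDeriv_eq _)⟩
  · push_cast
    ring
  · rw [deriv_fun_mul (hH.differentiable_coeff θ) (hK.differentiable_coeff θ)]
    ring

lemma inv {a : ℝ} (ha : a ≠ 0) (hH : HasLeadingTermC1 n (fun _ => a) H) :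
    HasLeadingTermC1 (-n) (fun _ => a⁻¹) fun p => (H p)⁻¹ := by
  have H_ne : ∀ᶠ p in radialInfinity, H p ≠ 0 :=
    ((tendsto_sub_nhds_zero_iff.1 hH.value.tendsto).eventually_ne ha).mono
      fun p hp => right_ne_zero_of_mul hp
  have polarDeriv_eq (v : ℝ × ℝ) : (fun p => -1 * ((H p)⁻¹ * (H p)⁻¹ * polarDeriv v H p))
      =ᶠ[radialInfinity] polarDeriv v fun p => (H p)⁻¹ := by
    filter_upwards [hH.differentiableAt, H_ne] with p hHp hp
    rw [polarDeriv_inv v hHp hp]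
    ring
  have hinv := hH.value.inv ha
  have hneg := hasLeadingTerm_angular (c := fun _ => -1) ⟨1, by simp⟩
  refine ⟨differentiable_const _, hH.differentiableAt.and H_ne |>.mono fun p hp => hp.1.inv hp.2,
    hinv, (hneg.mul ((hinv.mul hinv).mul hH.radial)).congr (by ring) (fun θ => ?_)
      (polarDeriv_eq _), (hneg.mul ((hinv.mul hinv).mul hH.angular)).congr (by ring) (fun θ => ?_)
      (polarDeriv_eq _)⟩
  · push_cast
    field_simp
  · simp

end HasLeadingTermC1

namespace HasLeadingTermC2

variable {n k : ℤ} {c : ℝ → ℝ} {H K : ℝ × ℝ → ℝ}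

lemma of_lt (hH : HasLeadingTermC2 n c H) (hnk : n < k) :
    HasLeadingTermC2 k (fun _ => 0) H where
  differentiable_coeff := differentiable_const _
  differentiableAt := hH.differentiableAt
  value := hH.value.of_lt hnk
  radial := by simpa using hH.radial.of_lt (by omega : n - 1 < k - 1)
  angular := by simpa using hH.angular.of_lt hnk
  radial_radial := by simpa using hH.radial_radial.of_lt (by omega : n - 2 < k - 2)
  angular_angular := by simpa using hH.angular_angular.of_lt hnk

lemma add_lower_order {a : ℝ} (hH : HasLeadingTermC2 n c H)
    (hK : HasLeadingTermC2 n (fun _ => 0) K) (hH_smooth : SmoothNear (outside a) H)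
    (hK_smooth : SmoothNear (outside a) K) : HasLeadingTermC2 n c fun p => H p + K p := by
  have polarDeriv_eqOn (v : ℝ × ℝ) : EqOn (fun p => polarDeriv v H p + polarDeriv v K p)
      (polarDeriv v fun p => H p + K p) (outside a) := fun p hp =>
    (polarDeriv_add v (hH_smooth.differentiableAt hp) (hK_smooth.differentiableAt hp)).symm
  have polarDeriv_eq (v : ℝ × ℝ) : (fun p => polarDeriv v H p + polarDeriv v K p)
      =ᶠ[radialInfinity] polarDeriv v fun p => H p + K p :=
    (eventually_outside a).mono (polarDeriv_eqOn v)
  have polarDeriv_polarDeriv_eq (v : ℝ × ℝ) :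
      (fun p => polarDeriv v (polarDeriv v H) p + polarDeriv v (polarDeriv v K) p)
        =ᶠ[radialInfinity] polarDeriv v (polarDeriv v fun p => H p + K p) := by
    filter_upwards [eventually_outside a] with p hp
    rw [← polarDeriv_eqOn_of_eqOn v (polarDeriv_eqOn v) hp]
    exact (polarDeriv_add v ((hH_smooth.polarDeriv v).differentiableAt hp)
      ((hK_smooth.polarDeriv v).differentiableAt hp)).symm
  exact ⟨⟨hH.differentiable_coeff,
    hH.differentiableAt.and hK.differentiableAt |>.mono fun p hp => hp.1.add hp.2,
    (hH.value.add hK.value).congr rfl (by simp) .rfl,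
    (hH.radial.add hK.radial).congr rfl (by simp) (polarDeriv_eq _),
    (hH.angular.add hK.angular).congr rfl (by simp) (polarDeriv_eq _)⟩,
    (hH.radial_radial.add hK.radial_radial).congr rfl (by simp) (polarDeriv_polarDeriv_eq _),
    (hH.angular_angular.add hK.angular_angular).congr rfl (by simp)
      (polarDeriv_polarDeriv_eq _)⟩

end HasLeadingTermC2

/-! ## Expansions in powers of the radius -/

lemma hasDerivAt_radial {H : ℝ × ℝ → ℝ} {p : ℝ × ℝ} (hH : DifferentiableAt ℝ H p) :
    HasDerivAt (fun r => H (r, p.2)) (∂r H p) p.1 :=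
  hH.hasFDerivAt.comp_hasDerivAt p.1 ((hasDerivAt_id p.1).prodMk (hasDerivAt_const p.1 p.2))

lemma hasDerivAt_angular {H : ℝ × ℝ → ℝ} {p : ℝ × ℝ} (hH : DifferentiableAt ℝ H p) :
    HasDerivAt (fun θ => H (p.1, θ)) (∂θ H p) p.2 :=
  hH.hasFDerivAt.comp_hasDerivAt p.2 ((hasDerivAt_const p.2 p.1).prodMk (hasDerivAt_id p.2))

/-- Smooth `2π`-periodic functions: the coefficients of the expansions. -/
structure IsSmoothPeriodic (c : ℝ → ℝ) : Prop where
  contDiff : ContDiff ℝ ∞ c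
  periodic : Function.Periodic c (2 * π)

lemma RegularAngular.isSmoothPeriodic {c : ℝ → ℝ} (hc : RegularAngular c) :
    IsSmoothPeriodic c := ⟨hc.1, hc.2.2⟩

lemma isSmoothPeriodic_const (a : ℝ) : IsSmoothPeriodic fun _ => a :=
  ⟨contDiff_const, fun _ => rfl⟩

lemma isSmoothPeriodic_sin : IsSmoothPeriodic Real.sin :=
  ⟨Real.contDiff_sin, Real.sin_periodic⟩

lemma isSmoothPeriodic_cos : IsSmoothPeriodic Real.cos :=
  ⟨Real.contDiff_cos, Real.cos_periodic⟩

namespace IsSmoothPeriodic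

variable {c : ℝ → ℝ}

lemma differentiable (hc : IsSmoothPeriodic c) : Differentiable ℝ c :=
  hc.contDiff.differentiable (by simp)

lemma deriv (hc : IsSmoothPeriodic c) : IsSmoothPeriodic (deriv c) :=
  ⟨(contDiff_infty_iff_deriv.1 hc.contDiff).2, fun θ => by
    rw [← deriv_comp_add_const, funext hc.periodic]⟩

lemma const_mul (hc : IsSmoothPeriodic c) (a : ℝ) : IsSmoothPeriodic fun θ => a * c θ :=
  ⟨contDiff_const.mul hc.contDiff, fun θ => congrArg (a * ·) (hc.periodic θ)⟩

lemma exists_abs_le (hc : IsSmoothPeriodic c) : ∃ C, ∀ θ, |c θ| ≤ C :=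
  let ⟨C, hC⟩ := (hc.periodic.isBounded_of_continuous Real.two_pi_pos.ne'
    hc.contDiff.continuous).exists_norm_le
  ⟨C, fun θ => hC _ (mem_range_self θ)⟩

end IsSmoothPeriodic

section RadialMonomial

variable {c : ℝ → ℝ} (n : ℤ)

lemma smoothNear_radialMonomial (hc : ContDiff ℝ ∞ c) {a : ℝ} (ha : 0 ≤ a) :
    SmoothNear (outside a) (radialMonomial n c) := fun _ hp =>
  (hc.comp contDiff_snd).contDiffAt.mul (analyticAt_fst.zpow (ha.trans_lt hp).ne').contDiffAt

lemma differentiableAt_radialMonomial (hc : Differentiable ℝ c) {p : ℝ × ℝ} (hp : p.1 ≠ 0) :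
    DifferentiableAt ℝ (radialMonomial n c) p :=
  ((hc p.2).comp p differentiableAt_snd).mul (differentiableAt_fst.zpow (.inl hp))

lemma radial_radialMonomial (hc : Differentiable ℝ c) :
    EqOn (∂r (radialMonomial n c)) (radialMonomial (n - 1) fun θ => n * c θ) (outside 0) := by
  intro p hp
  have hr : p.1 ≠ 0 := ne_of_gt hp
  have hderiv := (hasDerivAt_zpow n p.1 (.inl hr)).const_mul (c p.2)
  rw [(hasDerivAt_radial (differentiableAt_radialMonomial n hc hr)).unique hderiv,
    radialMonomial]
  ring

lemma angular_radialMonomial (hc : Differentiable ℝ c) :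
    EqOn (∂θ (radialMonomial n c)) (radialMonomial n (deriv c)) (outside 0) := fun p hp =>
  (hasDerivAt_angular (differentiableAt_radialMonomial n hc (ne_of_gt hp))).unique
    ((hc p.2).hasDerivAt.mul_const (p.1 ^ n))

lemma hasLeadingTermC2_radialMonomial (hc : IsSmoothPeriodic c) :
    HasLeadingTermC2 n c (radialMonomial n c) := by
  have eventuallyEq_of_eqOn {H K : ℝ × ℝ → ℝ} (h : EqOn H K (outside 0)) :
      K =ᶠ[radialInfinity] H := (eventually_outside 0).mono h.symm
  have hr := radial_radialMonomial n hc.differentiable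
  have hθ := angular_radialMonomial n hc.differentiable
  have hrr := (polarDeriv_eqOn_of_eqOn (1, 0) hr).trans
    (radial_radialMonomial (n - 1) (hc.const_mul n).differentiable)
  have hθθ := (polarDeriv_eqOn_of_eqOn (0, 1) hθ).trans
    (angular_radialMonomial n hc.deriv.differentiable)
  refine ⟨⟨hc.differentiable, (eventually_outside 0).mono fun p hp =>
      differentiableAt_radialMonomial n hc.differentiable (ne_of_gt hp),
    hasLeadingTerm_radialMonomial n hc.exists_abs_le,
    (hasLeadingTerm_radialMonomial _ (hc.const_mul n).exists_abs_le).congr rfl (fun _ => rfl)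
      (eventuallyEq_of_eqOn hr),
    (hasLeadingTerm_radialMonomial n hc.deriv.exists_abs_le).congr rfl (fun _ => rfl)
      (eventuallyEq_of_eqOn hθ)⟩,
    (hasLeadingTerm_radialMonomial _ ((hc.const_mul n).const_mul _).exists_abs_le).congr
      (by ring) (fun θ => ?_) (eventuallyEq_of_eqOn hrr),
    (hasLeadingTerm_radialMonomial n hc.deriv.deriv.exists_abs_le).congr rfl (fun _ => rfl)
      (eventuallyEq_of_eqOn hθθ)⟩
  push_cast
  ring

end RadialMonomial

section Remainder

variable {a : ℝ} {H : ℝ × ℝ → ℝ}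

lemma SmoothNear.polarDeriv_iterate {s : Set (ℝ × ℝ)} (hH : SmoothNear s H) (v : ℝ × ℝ) (j : ℕ) :
    SmoothNear s ((DCS.polarDeriv v)^[j] H) := by
  induction j with
  | zero => exact hH
  | succ j ih =>
    rw [Function.iterate_succ_apply']
    exact ih.polarDeriv v

lemma iteratedDeriv_angular (hH : SmoothNear (outside a) H) (j : ℕ) {r : ℝ} (hr : a < r)
    (θ : ℝ) : iteratedDeriv j (fun θ => H (r, θ)) θ = (∂θ^[j] H) (r, θ) := by
  induction j generalizing θ with
  | zero => rfl
  | succ j ih =>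
    rw [iteratedDeriv_succ, funext ih, Function.iterate_succ_apply']
    exact (hasDerivAt_angular (p := (r, θ))
      ((hH.polarDeriv_iterate _ j).differentiableAt hr)).deriv

lemma iteratedDeriv_radial (hH : SmoothNear (outside a) H) (i : ℕ) {r : ℝ} (hr : a < r)
    (θ : ℝ) : iteratedDeriv i (fun r => H (r, θ)) r = (∂r^[i] H) (r, θ) := by
  induction i generalizing r with
  | zero => rfl
  | succ i ih =>
    rw [iteratedDeriv_succ, Function.iterate_succ_apply',
      EventuallyEq.deriv_eq ((lt_mem_nhds hr).mono fun s hs => ih hs)]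
    exact (hasDerivAt_radial (p := (r, θ))
      ((hH.polarDeriv_iterate _ i).differentiableAt hr)).deriv

lemma hasLeadingTerm_zero_of_abs_le {n k : ℤ} {C R : ℝ} (hk : k < n)
    (hH : ∀ r θ, R < r → |H (r, θ)| ≤ C * r ^ k) : HasLeadingTerm n (fun _ => 0) H := by
  refine ⟨⟨0, by simp⟩, squeeze_zero_norm' ?_
    (by simpa using (tendsto_zpow_radialInfinity (sub_neg.2 hk)).const_mul C)⟩
  filter_upwards [eventually_outside 0, eventually_outside R] with p hp hpR
  have hr : (0 : ℝ) < p.1 := hp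
  calc ‖p.1 ^ (-n) * H p - 0‖ = p.1 ^ (-n) * |H p| := by
        rw [sub_zero, norm_mul, Real.norm_of_nonneg (zpow_nonneg hr.le _), Real.norm_eq_abs]
    _ ≤ p.1 ^ (-n) * (C * p.1 ^ k) := by gcongr; exact hH p.1 p.2 hpR
    _ = C * p.1 ^ (k - n) := by rw [sub_eq_neg_add, zpow_add₀ hr.ne']; ring

lemma IsRemainder.hasLeadingTerm_iterate {k : ℕ} {E : ℝ → ℝ → ℝ} (hE : IsRemainder k E)
    (hE_smooth : SmoothNear (outside a) (Function.uncurry E)) {n : ℤ} (hn : -k < n) {i j : ℕ}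
    (hij : i + j ≤ 2) :
    HasLeadingTerm (n - i) (fun _ => 0) (∂r^[i] (∂θ^[j] (Function.uncurry E))) := by
  obtain ⟨C, R, -, hC⟩ := hE i j hij
  refine hasLeadingTerm_zero_of_abs_le (C := C) (R := max R a) (k := -((k + i : ℕ) : ℤ))
    (by push_cast; omega) fun r θ hr => ?_
  obtain ⟨hRr, har⟩ := max_lt_iff.1 hr
  rw [zpow_neg, zpow_natCast, ← div_eq_mul_inv,
    ← iteratedDeriv_radial (hE_smooth.polarDeriv_iterate _ j) i har θ]
  refine (congrArg abs ?_).trans_le (hC r θ hRr)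
  refine EventuallyEq.iteratedDeriv_eq i ((lt_mem_nhds har).mono fun s hs => ?_)
  exact (iteratedDeriv_angular hE_smooth j hs θ).symm

lemma IsRemainder.hasLeadingTermC2 {k : ℕ} {E : ℝ → ℝ → ℝ} (hE : IsRemainder k E)
    (hE_smooth : SmoothNear (outside a) (Function.uncurry E)) {n : ℤ} (hn : -k < n) :
    HasLeadingTermC2 n (fun _ => 0) (Function.uncurry E) where
  differentiable_coeff := differentiable_const _
  differentiableAt := (eventually_outside a).mono fun _ => hE_smooth.differentiableAt
  value := by simpa using hE.hasLeadingTerm_iterate hE_smooth hn (i := 0) (j := 0) (by simp)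
  radial := by simpa using hE.hasLeadingTerm_iterate hE_smooth hn (i := 1) (j := 0) (by simp)
  angular := by simpa using hE.hasLeadingTerm_iterate hE_smooth hn (i := 0) (j := 1) (by simp)
  radial_radial := by
    simpa using hE.hasLeadingTerm_iterate hE_smooth hn (i := 2) (j := 0) (by simp)
  angular_angular := by
    simpa using hE.hasLeadingTerm_iterate hE_smooth hn (i := 0) (j := 2) (by simp)

end Remainder

lemma IsRemainder.hasLeadingTermC2_of_expansion {k : ℕ} {f : ℝ → ℝ → ℝ} {c d : ℝ → ℝ} {n : ℤ}
    {a : ℝ} (hf : IsRemainder k fun r θ => f r θ - (c θ * r ^ n + d θ * r ^ (n - 1)))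
    (hn : -k < n) (ha : 0 ≤ a) (hf_smooth : SmoothNear (outside a) (Function.uncurry f))
    (hc : IsSmoothPeriodic c) (hd : IsSmoothPeriodic d) :
    HasLeadingTermC2 n c (Function.uncurry f) := by
  have leading_smooth := smoothNear_radialMonomial n hc.contDiff ha
  have next_smooth := smoothNear_radialMonomial (n - 1) hd.contDiff ha
  have remainder_smooth : SmoothNear (outside a)
      (Function.uncurry fun r θ => f r θ - (c θ * r ^ n + d θ * r ^ (n - 1))) := fun p hp =>
    (hf_smooth p hp).sub ((leading_smooth p hp).add (next_smooth p hp))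
  have next := (hasLeadingTermC2_radialMonomial (n - 1) hd).of_lt (sub_one_lt n)
  have truncation := (hasLeadingTermC2_radialMonomial n hc).add_lower_order next leading_smooth
    next_smooth
  convert truncation.add_lower_order (hf.hasLeadingTermC2 remainder_smooth hn)
    (fun p hp => (leading_smooth p hp).add (next_smooth p hp)) remainder_smooth using 2 with p
  simp [radialMonomial, Function.uncurry]

/-! ## The wave operator in the far zone -/

/-- `N, A, B → 1` as `r → ∞`, together with their first derivatives: the part of `IsAMC` on which
the leading behaviour of `□` depends. -/
structure IsAsymptoticallyFlat (m : HTMetric) : Prop where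
  lapse : HasLeadingTermC1 0 (fun _ => 1) (Function.uncurry m.N)
  radial : HasLeadingTermC1 0 (fun _ => 1) (Function.uncurry m.A)
  sphere : HasLeadingTermC1 0 (fun _ => 1) (Function.uncurry m.B)

namespace IsRegularExterior

variable {m : HTMetric} {rH : ℝ}

lemma smoothNear_lapse (hm : IsRegularExterior m rH) :
    SmoothNear (outside rH) (Function.uncurry m.N) := by
  have sq_pos (p : ℝ × ℝ) (hp : p ∈ outside rH) : 0 < m.N p.1 p.2 ^ 2 :=
    pow_pos (hm.pos p.1 p.2 hp).1 2
  refine SmoothNear.congr (H := fun p => √(m.N p.1 p.2 ^ 2))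
    (fun p hp => (hm.horizon_N.smoothNear p hp).sqrt (sq_pos p hp).ne') (isOpen_outside rH)
    fun p hp => (Real.sqrt_sq (hm.pos p.1 p.2 hp).1.le).symm

lemma smoothNear_radial (hm : IsRegularExterior m rH) :
    SmoothNear (outside rH) (Function.uncurry m.A) := by
  obtain ⟨_, hNA, -⟩ := hm.horizon_NA
  refine SmoothNear.congr (H := fun p => m.N p.1 p.2 * m.A p.1 p.2 / m.N p.1 p.2)
    (fun p hp => (hNA.smoothNear p hp).div (hm.smoothNear_lapse p hp)
      (hm.pos p.1 p.2 hp).1.ne') (isOpen_outside rH)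
    fun p hp => (mul_div_cancel_left₀ _ (hm.pos p.1 p.2 hp).1.ne').symm

lemma smoothNear_sphere (hm : IsRegularExterior m rH) :
    SmoothNear (outside rH) (Function.uncurry m.B) :=
  let ⟨_, hB, _⟩ := hm.horizon_B
  hB.smoothNear

end IsRegularExterior

lemma IsAMC.isAsymptoticallyFlat {m : HTMetric} {rH M J : ℝ} (ha : IsAMC m M J)
    (hm : IsRegularExterior m rH) : IsAsymptoticallyFlat m := by
  have leading {f : ℝ → ℝ → ℝ} (a : ℝ)
      (hf : IsRemainder 2 fun r θ => f r θ - (1 * r ^ (0 : ℤ) + a * r ^ (0 - 1 : ℤ)))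
      (hf_smooth : SmoothNear (outside rH) (Function.uncurry f)) :
      HasLeadingTermC1 0 (fun _ => 1) (Function.uncurry f) :=
    (hf.hasLeadingTermC2_of_expansion (by norm_num) hm.rH_pos.le hf_smooth
      (isSmoothPeriodic_const 1) (isSmoothPeriodic_const a)).toHasLeadingTermC1
  exact ⟨leading (-M) (by simpa [sub_eq_add_neg, div_eq_mul_inv] using ha.N_exp)
      hm.smoothNear_lapse,
    leading M (by simpa [div_eq_mul_inv] using ha.A_exp) hm.smoothNear_radial,
    leading 0 (by simpa using ha.B_exp) hm.smoothNear_sphere⟩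

namespace IsAsymptoticallyFlat

variable {m : HTMetric}

lemma hasLeadingTermC1_angularCoeff (hm : IsAsymptoticallyFlat m) :
    HasLeadingTermC1 0 (fun _ => 1) m.angularCoeff := by
  have coeff := hm.lapse.mul hm.radial
  simp only [zero_add, mul_one] at coeff
  exact coeff

lemma hasLeadingTermC1_sq_mul_sphere_sq (hm : IsAsymptoticallyFlat m) :
    HasLeadingTermC1 2 (fun _ => 1) fun p => p.1 ^ 2 * m.B p.1 p.2 ^ 2 := by
  have area := (hasLeadingTermC2_radialMonomial 2 (isSmoothPeriodic_const 1)).mul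
    (hm.sphere.mul hm.sphere)
  simp only [one_mul, add_zero] at area
  convert area using 2 with p
  simp only [radialMonomial, Function.uncurry, one_mul, ← pow_two, zpow_ofNat]

lemma hasLeadingTermC1_radialCoeff (hm : IsAsymptoticallyFlat m) :
    HasLeadingTermC1 2 (fun _ => 1) m.radialCoeff := by
  have coeff := (hm.lapse.mul hm.hasLeadingTermC1_sq_mul_sphere_sq).mul
    (hm.radial.inv one_ne_zero)
  simp only [inv_one, mul_one, zero_add, neg_zero, add_zero] at coeff
  convert coeff using 2 with p
  simp only [HTMetric.radialCoeff, Function.uncurry, div_eq_mul_inv, mul_assoc]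

lemma hasLeadingTerm_volCoeff (hm : IsAsymptoticallyFlat m) :
    HasLeadingTerm 2 (fun _ => 1) m.volCoeff := by
  have coeff := (hm.hasLeadingTermC1_angularCoeff.mul hm.hasLeadingTermC1_sq_mul_sphere_sq).value
  simp only [mul_one, zero_add] at coeff
  convert coeff using 2 with p
  simp only [HTMetric.volCoeff, HTMetric.angularCoeff, mul_assoc]

end IsAsymptoticallyFlat

lemma hasLeadingTermC1_sin : HasLeadingTermC1 0 Real.sin fun p => Real.sin p.2 := by
  convert (hasLeadingTermC2_radialMonomial 0 isSmoothPeriodic_sin).toHasLeadingTermC1 using 2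
  simp only [radialMonomial, zpow_zero, mul_one]

lemma hasLeadingTerm_divGrad {P Q U : ℝ × ℝ → ℝ} {n : ℤ} {c : ℝ → ℝ} {a : ℝ}
    (hP : HasLeadingTermC1 2 (fun _ => 1) P) (hQ : HasLeadingTermC1 0 (fun _ => 1) Q)
    (hU : HasLeadingTermC2 n c U) (hU_smooth : SmoothNear (outside a) U) :
    HasLeadingTerm n (fun θ => Real.sin θ * deriv (deriv c) θ + Real.cos θ * deriv c θ
      + n * (n + 1) * (Real.sin θ * c θ)) (divGrad P Q U) := by
  have hPs := hP.mul hasLeadingTermC1_sin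
  have hQs := hQ.mul hasLeadingTermC1_sin
  have polarDeriv_mul_polarDeriv {K : ℝ × ℝ → ℝ} (v : ℝ × ℝ)
      (hK : ∀ᶠ p in radialInfinity, DifferentiableAt ℝ K p) :
      (fun p => K p * polarDeriv v (polarDeriv v U) p + polarDeriv v U p * polarDeriv v K p)
        =ᶠ[radialInfinity] polarDeriv v fun p => K p * polarDeriv v U p := by
    filter_upwards [hK, eventually_outside a] with p hKp hp
    exact (polarDeriv_mul v hKp ((hU_smooth.polarDeriv v).differentiableAt hp)).symm
  have hradial := (((hPs.value.mul hU.radial_radial).congr (by ring) (fun _ => rfl) .rfl).add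
    ((hU.radial.mul hPs.radial).congr (by ring) (fun _ => rfl) .rfl)).congr (k := n)
    (by ring) (fun _ => rfl) (polarDeriv_mul_polarDeriv _ hPs.differentiableAt)
  have hangular := (((hQs.value.mul hU.angular_angular).congr (by ring) (fun _ => rfl) .rfl).add
    ((hU.angular.mul hQs.angular).congr (by ring) (fun _ => rfl) .rfl)).congr (k := n)
    (by ring) (fun _ => rfl) (polarDeriv_mul_polarDeriv _ hQs.differentiableAt)
  refine (hradial.add hangular).congr rfl (fun θ => ?_) .rfl
  simp only [one_mul, Real.deriv_sin]
  push_cast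
  ring

/-! ## Axisymmetric spherical harmonics of degree `0` and `1` -/

lemma eq_apply_zero_of_hasDerivAt_eq_zero {g g' : ℝ → ℝ} (hg : ∀ θ, HasDerivAt g (g' θ) θ)
    (hg' : ∀ θ ∈ Ioo 0 π, g' θ = 0) {θ : ℝ} (hθ : θ ∈ Icc 0 π) : g θ = g 0 := by
  rcases hθ.1.eq_or_lt with rfl | hθ_pos
  · rfl
  obtain ⟨ξ, hξ, slope⟩ := exists_hasDerivAt_eq_slope g g' hθ_pos
    (fun x _ => (hg x).continuousAt.continuousWithinAt) fun x _ => hg x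
  rw [hg' ξ ⟨hξ.1, hξ.2.trans_le hθ.2⟩, eq_comm, div_eq_zero_iff] at slope
  exact sub_eq_zero.1 (slope.resolve_right (by rw [sub_zero]; exact hθ_pos.ne'))

lemma AxisSymm.eq_of_eqOn {f g : ℝ → ℝ} (hf : AxisSymm f) (hg : AxisSymm g)
    (hfg : EqOn f g (Icc 0 π)) : f = g := by
  funext θ
  have periodic : Function.Periodic (fun θ => f θ - g θ) (2 * π) := fun θ => by
    simp only [hf.2, hg.2]
  obtain ⟨y, hy, hθy⟩ := periodic.exists_mem_Ico₀ Real.two_pi_pos θ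
  suffices f y = g y by linarith
  rcases le_total y π with hy' | hy'
  · exact hfg ⟨hy.1, hy'⟩
  · have reflected := hfg (x := -y + 2 * π) ⟨by linarith [hy.2], by linarith⟩
    rwa [hf.2, hg.2, hf.1, hg.1] at reflected

/-- The axisymmetric spherical harmonics of degree `l`, regular or not:
`Δf + l (l + 1) f = 0` on the sphere without its poles. -/
def IsZonalHarmonic (l : ℝ) (f : ℝ → ℝ) : Prop :=
  ∀ θ ∈ Ioo 0 π, Real.sin θ * deriv (deriv f) θ + Real.cos θ * deriv f θ
    + l * (l + 1) * (Real.sin θ * f θ) = 0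

lemma IsZonalHarmonic.neg_one_sub {l : ℝ} {f : ℝ → ℝ} (h : IsZonalHarmonic l f) :
    IsZonalHarmonic (-1 - l) f := fun θ hθ => by linear_combination h θ hθ

namespace RegularAngular

variable {f : ℝ → ℝ}

lemma hasDerivAt (hf : RegularAngular f) (θ : ℝ) : HasDerivAt f (deriv f θ) θ :=
  (hf.isSmoothPeriodic.differentiable θ).hasDerivAt

lemma hasDerivAt_deriv (hf : RegularAngular f) (θ : ℝ) :
    HasDerivAt (deriv f) (deriv (deriv f) θ) θ :=
  (hf.isSmoothPeriodic.deriv.differentiable θ).hasDerivAt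

lemma eq_const_of_isZonalHarmonic (hf : RegularAngular f) (h : IsZonalHarmonic 0 f) :
    f = fun _ => f 0 := by
  have deriv_eq_zero (θ : ℝ) (hθ : θ ∈ Ioo 0 π) : deriv f θ = 0 := by
    have sin_mul_deriv := eq_apply_zero_of_hasDerivAt_eq_zero
      (fun θ => (Real.hasDerivAt_sin θ).mul (hf.hasDerivAt_deriv θ))
      (fun θ hθ => by linear_combination h θ hθ) (Ioo_subset_Icc_self hθ)
    simp only [Pi.mul_apply, Real.sin_zero, zero_mul] at sin_mul_deriv
    exact (mul_eq_zero.1 sin_mul_deriv).resolve_left (Real.sin_pos_of_mem_Ioo hθ).ne'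
  exact hf.2.eq_of_eqOn ⟨fun _ => rfl, fun _ => rfl⟩ fun θ hθ =>
    eq_apply_zero_of_hasDerivAt_eq_zero hf.hasDerivAt deriv_eq_zero hθ

/-- The Wronskian of `f` and the harmonic `cos θ`. -/
lemma sin_mul_wronskian_cos_eq_zero (hf : RegularAngular f) (h : IsZonalHarmonic 1 f) {θ : ℝ}
    (hθ : θ ∈ Icc 0 π) : Real.sin θ * (deriv f θ * Real.cos θ + f θ * Real.sin θ) = 0 := by
  have first_integral := eq_apply_zero_of_hasDerivAt_eq_zero
    (fun θ => (Real.hasDerivAt_sin θ).mul (((hf.hasDerivAt_deriv θ).mul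
      (Real.hasDerivAt_cos θ)).add ((hf.hasDerivAt θ).mul (Real.hasDerivAt_sin θ))))
    (fun θ hθ => by
      simp only [Pi.add_apply, Pi.mul_apply]
      linear_combination Real.cos θ * h θ hθ) hθ
  simpa only [Pi.mul_apply, Pi.add_apply, Real.sin_zero, zero_mul] using first_integral

lemma eq_mul_cos_of_isZonalHarmonic (hf : RegularAngular f) (h : IsZonalHarmonic 1 f) :
    f = fun θ => f 0 * Real.cos θ := by
  have first_integral (θ : ℝ) (hθ : θ ∈ Icc 0 π) :
      f θ * Real.cos θ - deriv f θ * Real.sin θ = f 0 := by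
    have const := eq_apply_zero_of_hasDerivAt_eq_zero
      (fun θ => ((hf.hasDerivAt θ).mul (Real.hasDerivAt_cos θ)).sub
        ((hf.hasDerivAt_deriv θ).mul (Real.hasDerivAt_sin θ)))
      (fun θ hθ => by
        have wronskian_eq_zero :=
          (mul_eq_zero.1 (hf.sin_mul_wronskian_cos_eq_zero h (Ioo_subset_Icc_self hθ))).resolve_left
            (Real.sin_pos_of_mem_Ioo hθ).ne'
        linear_combination wronskian_eq_zero - h θ hθ) hθ
    simpa using const
  refine hf.2.eq_of_eqOn ⟨fun θ => by simp, fun θ => by simp⟩ fun θ hθ => ?_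
  linear_combination Real.cos θ * first_integral θ hθ + hf.sin_mul_wronskian_cos_eq_zero h hθ
    - f θ * Real.sin_sq_add_cos_sq θ

end RegularAngular

/-! ## The scalar field at radial infinity -/

lemma FallsOff.tendsto_zpow_mul {rH : ℝ} {S : (Fin 4 → ℝ) → ℝ} (hS : FallsOff rH S) {k : ℤ}
    (hk : k < 5) {θ : ℝ} (hθ : θ ∈ Ioo 0 π) :
    Tendsto (fun r : ℝ => r ^ k * S ![0, r, θ, 0]) atTop (𝓝 0) := by
  obtain ⟨C, R, hR, hC⟩ := hS
  have bound_tendsto := (tendsto_zpow_atTop_zero (by omega : k - 5 < 0)).const_mul C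
  rw [mul_zero] at bound_tendsto
  refine squeeze_zero_norm' ?_ bound_tendsto
  filter_upwards [eventually_gt_atTop R, eventually_gt_atTop rH] with r hr hr'
  have hr0 : 0 < r := hR.trans hr
  rw [Real.norm_eq_abs, abs_mul, abs_of_pos (zpow_pos hr0 k)]
  calc r ^ k * |S ![0, r, θ, 0]| ≤ r ^ k * (C / r ^ 5) :=
        mul_le_mul_of_nonneg_left (hC ![0, r, θ, 0] ⟨hr', hθ.1, hθ.2⟩ hr) (zpow_pos hr0 k).le
    _ = C * r ^ (k - 5) := by
        rw [zpow_sub₀ hr0.ne']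
        norm_cast
        ring

namespace HasLeadingTerm

variable {n : ℤ} {c : ℝ → ℝ} {H : ℝ × ℝ → ℝ}

lemma exists_abs_le (hH : HasLeadingTerm n c H) :
    ∃ C, ∀ᶠ r in atTop, ∀ θ, |H (r, θ)| ≤ C * r ^ n := by
  obtain ⟨C, hC⟩ := hH.bounded
  have near : ∀ᶠ p in radialInfinity, |p.1 ^ (-n) * H p - c p.2| < 1 := by
    simpa only [Real.dist_eq, sub_zero] using Metric.tendsto_nhds.1 hH.tendsto 1 one_pos
  obtain ⟨P, hP, Q, hQ, near⟩ := eventually_prod_iff.1 near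
  refine ⟨C + 1, (hP.and (eventually_gt_atTop 0)).mono fun r hr θ => ?_⟩
  have rescaled : |r ^ (-n) * H (r, θ)| ≤ C + 1 := by
    have := abs_add_le (r ^ (-n) * H (r, θ) - c θ) (c θ)
    rw [sub_add_cancel] at this
    linarith [hC θ, near hr.1 (eventually_top.1 hQ θ)]
  rwa [zpow_neg, inv_mul_eq_div, abs_div, abs_of_pos (zpow_pos hr.2 n),
    div_le_iff₀ (zpow_pos hr.2 n)] at rescaled

lemma tendsto_integral {a : ℝ} (hH : HasLeadingTerm 0 c H) (hH_cont : ContinuousOn H (outside a)) :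
    Tendsto (fun r => ∫ θ in (0 : ℝ)..π, H (r, θ)) atTop (𝓝 (∫ θ in (0 : ℝ)..π, c θ)) := by
  obtain ⟨C, hC⟩ := hH.exists_abs_le
  refine intervalIntegral.tendsto_integral_filter_of_dominated_convergence (fun _ => C) ?_ ?_
    intervalIntegrable_const (.of_forall fun θ _ => by simpa using hH.tendsto_ray θ)
  · filter_upwards [eventually_gt_atTop a] with r hr
    exact (hH_cont.comp_continuous (by fun_prop) fun _ => hr).aestronglyMeasurable
  · exact hC.mono fun r hr => .of_forall fun θ _ => by simpa using hr θ

end HasLeadingTerm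

section Scalar

variable {m : HTMetric} {rH ε : ℝ} {Φ : ℝ → ℝ → ℝ}

lemma tendsto_zpow_mul_divGrad (hm : IsRegularExterior m rH) (hflat : IsAsymptoticallyFlat m)
    (hfall : FallsOff rH (pontryagin m.g))
    (hΦ : SmoothNear (outside rH) (Function.uncurry Φ)) (heq : SolvesDCS m rH ε Φ) {n : ℤ}
    (hn : -2 ≤ n) {θ : ℝ} (hθ : θ ∈ Ioo 0 π) :
    Tendsto (fun r => r ^ (-n) * divGrad m.radialCoeff m.angularCoeff (Function.uncurry Φ) (r, θ))
      atTop (𝓝 0) := by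
  have source := ((hflat.hasLeadingTerm_volCoeff.tendsto_ray θ).mul
    (hfall.tendsto_zpow_mul (k := 2 - n) (by omega) hθ)).const_mul (-ε * Real.sin θ)
  simp only [mul_zero] at source
  refine source.congr' ?_
  filter_upwards [eventually_gt_atTop rH, eventually_gt_atTop 0] with r hr hr0
  have hx : ![0, r, θ, 0] ∈ exterior rH := ⟨hr, hθ.1, hθ.2⟩
  have box_eq := hm.volDensity_mul_box hΦ hx
  rw [hm.volDensity_eq hx, eq_neg_of_add_eq_zero_left (heq _ hx)] at box_eq
  simp only [Matrix.cons_val] at box_eq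
  rw [← box_eq, show -n = -2 + (2 - n) by ring, zpow_add₀ hr0.ne']
  ring

lemma isZonalHarmonic_of_hasLeadingTermC2 (hm : IsRegularExterior m rH)
    (hflat : IsAsymptoticallyFlat m) (hfall : FallsOff rH (pontryagin m.g))
    (hΦ : SmoothNear (outside rH) (Function.uncurry Φ)) (heq : SolvesDCS m rH ε Φ) {n : ℤ}
    (hn : -2 ≤ n) {c : ℝ → ℝ} (hc : HasLeadingTermC2 n c (Function.uncurry Φ)) :
    IsZonalHarmonic n c := fun θ hθ =>
  tendsto_nhds_unique
    ((hasLeadingTerm_divGrad hflat.hasLeadingTermC1_radialCoeff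
      hflat.hasLeadingTermC1_angularCoeff hc hΦ).tendsto_ray θ)
    (tendsto_zpow_mul_divGrad hm hflat hfall hΦ heq hn hθ)

lemma tendsto_wronskianFlux (hm : IsRegularExterior m rH) (hflat : IsAsymptoticallyFlat m)
    {V U : ℝ × ℝ → ℝ} {n k : ℤ} {v u : ℝ → ℝ} (hV : HasLeadingTermC1 k v V)
    (hU : HasLeadingTermC1 n u U) (hnk : n + k = -1) (hV_smooth : SmoothNear (outside rH) V)
    (hU_smooth : SmoothNear (outside rH) U) :
    Tendsto (m.wronskianFlux V U) atTop
      (𝓝 (∫ θ in (0 : ℝ)..π, (n - k : ℝ) * (Real.sin θ * (v θ * u θ)))) := by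
  have neg_one := hasLeadingTerm_angular (c := fun _ => -1) ⟨1, by simp⟩
  have leading := (hflat.hasLeadingTermC1_radialCoeff.value.mul hasLeadingTermC1_sin.value).mul
    (((hV.value.mul hU.radial).congr (k := -2) (by omega) (fun _ => rfl) .rfl).add
      ((neg_one.mul (hU.value.mul hV.radial)).congr (by omega) (fun _ => rfl) .rfl))
  refine (leading.congr (by norm_num) (fun θ => ?_) (.of_forall fun p => ?_)).tendsto_integral
    (((hm.smoothNear_radialCoeff.mul (smoothNear_sin _)).mul
      (hV_smooth.wronskian hU_smooth (1, 0))).continuousOn)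
  · ring
  · simp only [wronskian]
    ring

end Scalar

lemma legendreP_zero (ξ : ℝ) : legendreP 0 ξ = 1 := by simp [legendreP]

lemma legendreP_one (ξ : ℝ) : legendreP 1 ξ = ξ := by simp [legendreP, iteratedDeriv_one]

lemma mode_zero_mul_cos (c : ℝ) : mode 0 (fun θ => c * Real.cos θ) = 0 := by
  simp [mode, legendreP_zero, mul_assoc, mul_comm (Real.cos _)]

lemma mode_one_mul_cos (c : ℝ) : mode 1 (fun θ => c * Real.cos θ) = c := by
  have integrand (θ : ℝ) : c * Real.cos θ * legendreP 1 (Real.cos θ) * Real.sin θ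
      = c * (Real.sin θ * Real.cos θ ^ 2) := by
    rw [legendreP_one]
    ring
  simp only [mode, integrand, intervalIntegral.integral_const_mul, integral_sin_mul_cos_sq]
  norm_num
  ring

section Expansion

variable {m : HTMetric} {rH ε : ℝ} {Φ : ℝ → ℝ → ℝ} {μ₁ μ₂ : ℝ → ℝ}

lemma hasLeadingTermC2_of_scalar_expansion (hr : 0 ≤ rH)
    (hΦ : SmoothNear (outside rH) (Function.uncurry Φ)) (hμ₁ : RegularAngular μ₁)
    (hμ₂ : RegularAngular μ₂)
    (hexp : IsRemainder 3 fun r θ => Φ r θ - (μ₁ θ / r + μ₂ θ / r ^ 2)) :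
    HasLeadingTermC2 (-1) μ₁ (Function.uncurry Φ) :=
  IsRemainder.hasLeadingTermC2_of_expansion (k := 3) (d := μ₂)
    (by simpa [div_eq_mul_inv, zpow_ofNat] using hexp)
    (by norm_num) hr hΦ hμ₁.isSmoothPeriodic hμ₂.isSmoothPeriodic

lemma hasLeadingTermC2_of_dipole_expansion (hr : 0 ≤ rH)
    (hΦ : SmoothNear (outside rH) (Function.uncurry Φ)) (hμ₂ : RegularAngular μ₂)
    (hexp : IsRemainder 3 fun r θ => Φ r θ - μ₂ θ / r ^ 2) :
    HasLeadingTermC2 (-2) μ₂ (Function.uncurry Φ) :=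
  IsRemainder.hasLeadingTermC2_of_expansion (k := 3) (d := fun _ => 0)
    (by simpa [div_eq_mul_inv, zpow_ofNat] using hexp)
    (by norm_num) hr hΦ hμ₂.isSmoothPeriodic (isSmoothPeriodic_const 0)

lemma IsGreenSolution.hasLeadingTermC1 {φ₀ : ℝ → ℝ → ℝ} (hφ : IsGreenSolution m rH φ₀)
    (hr : 0 ≤ rH) (hφ_smooth : SmoothNear (outside rH) (Function.uncurry φ₀)) :
    HasLeadingTermC1 1 Real.cos (Function.uncurry φ₀) := by
  obtain ⟨ψ, hψ, hexp⟩ := hφ.expansion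
  refine (IsRemainder.hasLeadingTermC2_of_expansion (k := 1) (d := ψ) ?_ (by norm_num) hr
    hφ_smooth isSmoothPeriodic_cos hψ.isSmoothPeriodic).toHasLeadingTermC1
  simpa [legendreP_one, mul_comm (Real.cos _)] using hexp

/-- The flux of `∇Φ` through large spheres measures the monopole `μ₁`; it vanishes since `*RR` is
odd under the equatorial reflection. -/
lemma monopole_eq_zero (hm : IsRegularExterior m rH) (hflat : IsAsymptoticallyFlat m)
    (hfall : FallsOff rH (pontryagin m.g)) (hΦ : ∃ b, ExtendsSmoothly rH Φ b)
    (heq : SolvesDCS m rH ε Φ) (hμ₁ : RegularAngular μ₁)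
    (hexp : HasLeadingTermC2 (-1) μ₁ (Function.uncurry Φ)) : μ₁ = fun _ => 0 := by
  have hΦ_smooth : SmoothNear (outside rH) (Function.uncurry Φ) := hΦ.choose_spec.smoothNear
  have const : μ₁ = fun _ => μ₁ 0 := hμ₁.eq_const_of_isZonalHarmonic <| by
    simpa using (isZonalHarmonic_of_hasLeadingTermC2 hm hflat hfall hΦ_smooth heq
      (by norm_num) hexp).neg_one_sub
  have one_leading : HasLeadingTermC1 0 (fun _ => 1) fun _ => 1 := by
    convert (hasLeadingTermC2_radialMonomial 0 (isSmoothPeriodic_const 1)).toHasLeadingTermC1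
      using 2
    simp only [radialMonomial, zpow_zero, mul_one]
  have flux := tendsto_wronskianFlux hm hflat one_leading hexp.toHasLeadingTermC1 (by norm_num)
    (smoothNear_of_contDiff contDiff_const _) hΦ_smooth
  have flux_zero : Tendsto (m.wronskianFlux (fun _ => 1) (Function.uncurry Φ)) atTop (𝓝 0) :=
    tendsto_const_nhds.congr' <| (eventually_gt_atTop rH).mono fun R hR =>
      (wronskianFlux_one_eq_zero hm hΦ heq hR).symm
  have monopole := tendsto_nhds_unique flux flux_zero
  rw [const] at monopole ⊢
  norm_num at monopole
  rw [monopole]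

lemma dipole_eq_mul_cos (hm : IsRegularExterior m rH) (hflat : IsAsymptoticallyFlat m)
    (hfall : FallsOff rH (pontryagin m.g)) (hΦ : SmoothNear (outside rH) (Function.uncurry Φ))
    (heq : SolvesDCS m rH ε Φ) (hμ₂ : RegularAngular μ₂)
    (hexp : HasLeadingTermC2 (-2) μ₂ (Function.uncurry Φ)) :
    μ₂ = fun θ => mode 1 μ₂ * Real.cos θ := by
  have dipole := hμ₂.eq_mul_cos_of_isZonalHarmonic <| by
    have harmonic := (isZonalHarmonic_of_hasLeadingTermC2 hm hflat hfall hΦ heq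
      (by norm_num) hexp).neg_one_sub
    norm_num at harmonic
    exact harmonic
  have mode_eq : mode 1 μ₂ = μ₂ 0 := by
    rw [dipole, mode_one_mul_cos]
    simp
  rwa [mode_eq]

lemma exists_isSourceDensity_tendsto_integral (hm : IsRegularExterior m rH)
    (hflat : IsAsymptoticallyFlat m) (hΦ : ∃ b, ExtendsSmoothly rH Φ b)
    (heq : SolvesDCS m rH ε Φ) {c : ℝ}
    (hexp : HasLeadingTermC1 (-2) (fun θ => c * Real.cos θ) (Function.uncurry Φ))
    {v : ℝ → ℝ → ℝ} (hv : ∃ b, ExtendsSmoothly rH v b)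
    (hbox : ∀ x ∈ exterior rH, box m.g (lift v) x = 0)
    (hv_exp : HasLeadingTermC1 1 Real.cos (Function.uncurry v)) :
    ∃ G, IsSourceDensity m rH ε v G ∧
      Tendsto (fun R => ∫ r in rH..R, ∫ θ in (0 : ℝ)..π, G (r, θ)) atTop (𝓝 (2 * c)) := by
  obtain ⟨G, hG, hflux⟩ := exists_isSourceDensity hm hΦ heq hv hbox
  have flux := (tendsto_wronskianFlux hm hflat hv_exp hexp (by norm_num)
    hv.choose_spec.smoothNear hΦ.choose_spec.smoothNear).neg
  have integrand (θ : ℝ) : ((-2 : ℤ) - (1 : ℤ) : ℝ) *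
      (Real.sin θ * (Real.cos θ * (c * Real.cos θ)))
      = -(3 * c) * (Real.sin θ * Real.cos θ ^ 2) := by
    push_cast
    ring
  have limit : -∫ θ in (0 : ℝ)..π, ((-2 : ℤ) - (1 : ℤ) : ℝ) *
      (Real.sin θ * (Real.cos θ * (c * Real.cos θ))) = 2 * c := by
    simp only [integrand, intervalIntegral.integral_const_mul, integral_sin_mul_cos_sq]
    norm_num
    ring
  rw [limit] at flux
  exact ⟨G, hG, flux.congr' ((eventually_gt_atTop rH).mono fun R hR => (hflux R hR).symm)⟩

end Expansion

/-! ## Decay of the source density -/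

lemma exists_abs_le_mul_zpow {F : ℝ × ℝ → ℝ} {a D : ℝ} {n : ℤ} (ha : 0 < a)
    (hF : ContinuousOn F (outsideOrOn a))
    (hD : ∀ᶠ r in atTop, ∀ θ ∈ Ioo 0 π, |F (r, θ)| ≤ D * r ^ n) :
    ∃ D, ∀ r θ, a < r → θ ∈ Ioo 0 π → |F (r, θ)| ≤ D * r ^ n := by
  obtain ⟨R, hR⟩ := eventually_atTop.1 hD
  have rescaled_cont : ContinuousOn (fun p : ℝ × ℝ => F p * p.1 ^ (-n)) (Icc a R ×ˢ Icc 0 π) :=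
    (hF.mono fun p hp => hp.1.1).mul
      (continuousOn_fst.zpow₀ _ fun p hp => .inl (ha.trans_le hp.1.1).ne')
  obtain ⟨D', hD'⟩ := (isCompact_Icc.prod isCompact_Icc).exists_bound_of_continuousOn rescaled_cont
  refine ⟨max D D', fun r θ hr hθ => ?_⟩
  have pow_pos : 0 < r ^ n := zpow_pos (ha.trans hr) n
  rcases le_total R r with hRr | hrR
  · exact (hR r hRr θ hθ).trans (mul_le_mul_of_nonneg_right (le_max_left _ _) pow_pos.le)
  · have bound := hD' (r, θ) ⟨⟨hr.le, hrR⟩, Ioo_subset_Icc_self hθ⟩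
    rw [Real.norm_eq_abs, zpow_neg, ← div_eq_mul_inv, abs_div, abs_of_pos pow_pos,
      div_le_iff₀ pow_pos] at bound
    exact bound.trans (mul_le_mul_of_nonneg_right (le_max_right _ _) pow_pos.le)

lemma IsSourceDensity.exists_abs_le {m : HTMetric} {rH ε : ℝ} {v : ℝ → ℝ → ℝ} {G : ℝ × ℝ → ℝ}
    (hG : IsSourceDensity m rH ε v G) (hm : IsRegularExterior m rH)
    (hflat : IsAsymptoticallyFlat m) (hfall : FallsOff rH (pontryagin m.g)) {n : ℤ} {c : ℝ → ℝ}
    (hv : HasLeadingTerm n c (Function.uncurry v)) :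
    ∃ D, ∀ r θ, rH < r → θ ∈ Ioo 0 π → |G (r, θ)| ≤ D * r ^ (n - 3) := by
  obtain ⟨C, R, hR, hC⟩ := hfall
  obtain ⟨D, hD⟩ := (hv.mul (hflat.hasLeadingTerm_volCoeff.mul
    hasLeadingTermC1_sin.value)).exists_abs_le
  refine exists_abs_le_mul_zpow (D := |ε| * (C * D)) hm.rH_pos hG.continuousOn ?_
  filter_upwards [hD, eventually_gt_atTop R, eventually_gt_atTop rH] with r hD hRr hr θ hθ
  have hx : ![0, r, θ, 0] ∈ exterior rH := ⟨hr, hθ.1, hθ.2⟩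
  have G_eq := hG.eq _ hx
  have fall := hC _ hx hRr
  rw [hm.volDensity_eq hx] at G_eq
  simp only [Matrix.cons_val, lift] at G_eq fall
  have r_pos : 0 < r := hR.trans hRr
  calc |G (r, θ)| = |ε| * (|pontryagin m.g ![0, r, θ, 0]| *
        |v r θ * (m.volCoeff (r, θ) * Real.sin θ)|) := by
        rw [G_eq, ← abs_mul, ← abs_mul]
        ring_nf
    _ ≤ |ε| * (C / r ^ 5 * (D * r ^ (n + (2 + 0)))) := by
        gcongr
        · exact (abs_nonneg _).trans fall
        · exact hD θ
    _ = |ε| * (C * D) * r ^ (n - 3) := by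
        rw [show n + (2 + 0) = n - 3 + 5 by ring, zpow_add₀ r_pos.ne']
        norm_cast
        field_simp

/-! ## Integration over slices -/

section ProductIntegrals

variable {α β : Type*} [MeasurableSpace α] [MeasurableSpace β] {μ : Measure α} {ν : Measure β}
  [SFinite μ] [SFinite ν] {s : Set α} {t : Set β}

lemma integrableOn_prod_of_abs_le (hs : MeasurableSet s) (ht : MeasurableSet t) (hνt : ν t < ⊤)
    {f : α × β → ℝ} {b : α → ℝ} (hf : AEStronglyMeasurable f ((μ.prod ν).restrict (s ×ˢ t)))
    (hb : IntegrableOn b s μ) (hfb : ∀ p ∈ s ×ˢ t, |f p| ≤ b p.1) :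
    IntegrableOn f (s ×ˢ t) (μ.prod ν) := by
  have : IsFiniteMeasure (ν.restrict t) := ⟨by simpa using hνt⟩
  have bound_integrable : IntegrableOn (fun p : α × β => b p.1) (s ×ˢ t) (μ.prod ν) := by
    rw [IntegrableOn, ← Measure.prod_restrict]
    exact hb.comp_fst _
  exact Integrable.mono' bound_integrable hf
    ((ae_restrict_iff' (hs.prod ht)).2 (ae_of_all _ hfb))

lemma setIntegral_prod_mul_of_fiber_integral_eq (hs : MeasurableSet s) {g : α → ℝ}
    {j : α × β → ℝ} {c : ℝ} (hgj : IntegrableOn (fun p => g p.1 * j p) (s ×ˢ t) (μ.prod ν))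
    (hj : ∀ x ∈ s, ∫ y in t, j (x, y) ∂ν = c) :
    ∫ p in s ×ˢ t, g p.1 * j p ∂μ.prod ν = (∫ x in s, g x ∂μ) * c := by
  rw [setIntegral_prod _ hgj, ← integral_mul_const]
  refine setIntegral_congr_fun hs fun x hx => ?_
  simp only [integral_const_mul, hj x hx]

end ProductIntegrals

lemma integrableOn_const_mul_zpow_neg_two {a : ℝ} (ha : 0 < a) (D : ℝ) :
    IntegrableOn (fun r : ℝ => D * r ^ (-2 : ℤ)) (Ioi a) := by
  refine IntegrableOn.congr_fun
    ((integrableOn_Ioi_rpow_of_lt (a := -2) (by norm_num) ha).const_mul D)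
    (fun r _ => ?_) measurableSet_Ioi
  simp only [← Real.rpow_intCast]
  norm_num

lemma setIntegral_Ioo_eq_intervalIntegral {a b : ℝ} (hab : a ≤ b) (f : ℝ → ℝ) :
    ∫ x in Ioo a b, f x = ∫ x in a..b, f x := by
  rw [intervalIntegral.integral_of_le hab, integral_Ioc_eq_integral_Ioo]

lemma setIntegral_Ioi_prod_Ioo_eq_of_tendsto {F : ℝ × ℝ → ℝ} {a b c I : ℝ} (hbc : b ≤ c)
    (hF : IntegrableOn F (Ioi a ×ˢ Ioo b c))
    (hI : Tendsto (fun R => ∫ x in a..R, ∫ y in b..c, F (x, y)) atTop (𝓝 I)) :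
    ∫ p in Ioi a ×ˢ Ioo b c, F p = I := by
  have inner_integrable : IntegrableOn (fun x => ∫ y in b..c, F (x, y)) (Ioi a) := by
    rw [IntegrableOn, Measure.volume_eq_prod, ← Measure.prod_restrict] at hF
    exact hF.integral_prod_left.congr
      (ae_of_all _ fun x => setIntegral_Ioo_eq_intervalIntegral hbc fun y => F (x, y))
  rw [Measure.volume_eq_prod] at hF ⊢
  rw [setIntegral_prod _ hF]
  simp only [setIntegral_Ioo_eq_intervalIntegral hbc]
  exact tendsto_nhds_unique (intervalIntegral_tendsto_integral_Ioi a inner_integrable tendsto_id) hI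

/-- The coordinate domain `(r, θ, φ)` without identifying `φ` and `φ + 2π`. -/
def sliceChart (rH : ℝ) : Set (ℝ × ℝ × ℝ) := Ioi rH ×ˢ Ioo 0 π ×ˢ univ

/-- `X^μ ∂_μ (t - h)` for `X = ∂_t + Ω ∂_φ`, i.e. `X^μ dΣ_μ` in units of `√(-g) dr dθ dφ`. -/
noncomputable def sliceWeight (Ω : ℝ) (h : ℝ → ℝ → ℝ → ℝ) (p : ℝ × ℝ × ℝ) : ℝ :=
  1 - Ω * deriv (h p.1 p.2.1) p.2.2

/-- The linear map `(t, r, θ, φ) ↦ (r, θ, φ)`. -/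
noncomputable def spatialProj : (Fin 4 → ℝ) →L[ℝ] ℝ × ℝ × ℝ :=
  (ContinuousLinearMap.proj 1).prod ((ContinuousLinearMap.proj 2).prod (ContinuousLinearMap.proj 3))

lemma isOpen_sliceChart (rH : ℝ) : IsOpen (sliceChart rH) :=
  isOpen_Ioi.prod (isOpen_Ioo.prod isOpen_univ)

lemma sliceDomain_subset_sliceChart (rH : ℝ) : sliceDomain rH ⊆ sliceChart rH :=
  fun _ hp => ⟨hp.1, hp.2.1, trivial⟩

lemma measurableSet_sliceDomain (rH : ℝ) : MeasurableSet (sliceDomain rH) :=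
  measurableSet_Ioi.prod (measurableSet_Ioo.prod measurableSet_Ioo)

lemma integral_sliceDomain {a I : ℝ} {G : ℝ × ℝ → ℝ} {j : ℝ × ℝ × ℝ → ℝ}
    (hG : IntegrableOn G (Ioi a ×ˢ Ioo 0 π))
    (hGj : IntegrableOn (fun p => G (p.1, p.2.1) * j p) (sliceDomain a))
    (hj : ∀ r θ, a < r → θ ∈ Ioo 0 π → ∫ φ in (0 : ℝ)..2 * π, j (r, θ, φ) = 2 * π)
    (hI : Tendsto (fun R => ∫ r in a..R, ∫ θ in (0 : ℝ)..π, G (r, θ)) atTop (𝓝 I)) :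
    ∫ p in sliceDomain a, G (p.1, p.2.1) * j p = 2 * π * I := by
  have assoc : MeasurePreserving (MeasurableEquiv.prodAssoc (α := ℝ) (β := ℝ) (γ := ℝ)) :=
    volume_preserving_prodAssoc
  have embedding := (MeasurableEquiv.prodAssoc (α := ℝ) (β := ℝ) (γ := ℝ)).measurableEmbedding
  have preimage : MeasurableEquiv.prodAssoc ⁻¹' sliceDomain a
      = (Ioi a ×ˢ Ioo 0 π) ×ˢ Ioo 0 (2 * π) := by
    ext p
    exact and_assoc.symm
  rw [← assoc.integrableOn_comp_preimage embedding, preimage] at hGj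
  rw [← assoc.setIntegral_preimage_emb embedding, preimage,
    ← setIntegral_Ioi_prod_Ioo_eq_of_tendsto Real.pi_pos.le hG hI, mul_comm (2 * π)]
  refine setIntegral_prod_mul_of_fiber_integral_eq (measurableSet_Ioi.prod measurableSet_Ioo) hGj
    fun x hx => ?_
  rw [setIntegral_Ioo_eq_intervalIntegral Real.two_pi_pos.le]
  exact hj x.1 x.2 hx.1 hx.2

namespace IsSlice

variable {rH Ω : ℝ} {h : ℝ → ℝ → ℝ → ℝ}

lemma differentiableAt (hh : IsSlice rH h) {p : ℝ × ℝ × ℝ} (hp : p ∈ sliceChart rH) :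
    DifferentiableAt ℝ (fun p : ℝ × ℝ × ℝ => h p.1 p.2.1 p.2.2) p :=
  (hh.smooth.contDiffAt ((isOpen_sliceChart rH).mem_nhds hp)).differentiableAt (by norm_num)

lemma hasDerivAt (hh : IsSlice rH h) {p : ℝ × ℝ × ℝ} (hp : p ∈ sliceChart rH) :
    HasDerivAt (h p.1 p.2.1)
      (fderiv ℝ (fun p : ℝ × ℝ × ℝ => h p.1 p.2.1 p.2.2) p (0, 0, 1)) p.2.2 :=
  (hh.differentiableAt hp).hasFDerivAt.comp_hasDerivAt p.2.2 (f := fun φ => (p.1, p.2.1, φ))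
    ((hasDerivAt_const _ _).prodMk ((hasDerivAt_const _ _).prodMk (hasDerivAt_id _)))

lemma continuousOn_sliceWeight (hh : IsSlice rH h) :
    ContinuousOn (sliceWeight Ω h) (sliceChart rH) := by
  have deriv_cont : ContinuousOn (fun p : ℝ × ℝ × ℝ => deriv (h p.1 p.2.1) p.2.2)
      (sliceChart rH) :=
    ((hh.smooth.continuousOn_fderiv_of_isOpen (isOpen_sliceChart rH) (by norm_num)).clm_apply
      continuousOn_const).congr fun _ hp => (hh.hasDerivAt hp).deriv
  exact continuousOn_const.sub (continuousOn_const.mul deriv_cont)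

lemma exists_abs_sliceWeight_le (hh : IsSlice rH h) :
    ∃ K, ∀ p ∈ sliceChart rH, |sliceWeight Ω h p| ≤ K := by
  obtain ⟨K, hK⟩ := hh.bounded
  refine ⟨1 + |Ω| * K, fun p hp => (abs_sub _ _).trans ?_⟩
  rw [abs_one, abs_mul]
  gcongr
  exact hK _ _ _ hp.1 hp.2.1.1 hp.2.1.2

lemma integral_sliceWeight (hh : IsSlice rH h) {r θ : ℝ} (hr : rH < r) (hθ : θ ∈ Ioo 0 π) :
    ∫ φ in (0 : ℝ)..2 * π, sliceWeight Ω h (r, θ, φ) = 2 * π := by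
  have hasDerivAt_primitive (φ : ℝ) :
      HasDerivAt (fun φ => φ - Ω * h r θ φ) (sliceWeight Ω h (r, θ, φ)) φ :=
    (hasDerivAt_id φ).sub
      ((hh.hasDerivAt (p := (r, θ, φ)) ⟨hr, hθ, trivial⟩).differentiableAt.hasDerivAt.const_mul Ω)
  have weight_cont : Continuous fun φ => sliceWeight Ω h (r, θ, φ) :=
    hh.continuousOn_sliceWeight.comp_continuous (by fun_prop) fun _ => ⟨hr, hθ, trivial⟩
  have periodic := hh.periodic r θ 0
  rw [zero_add] at periodic
  rw [intervalIntegral.integral_eq_sub_of_hasDerivAt (fun φ _ => hasDerivAt_primitive φ)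
    (weight_cont.intervalIntegrable _ _), periodic]
  ring

lemma hasFDerivAt_time_sub (hh : IsSlice rH h) {p : ℝ × ℝ × ℝ} (hp : p ∈ sliceChart rH) :
    HasFDerivAt (fun y : Fin 4 → ℝ => y 0 - h (y 1) (y 2) (y 3))
      (ContinuousLinearMap.proj 0
        - (fderiv ℝ (fun p : ℝ × ℝ × ℝ => h p.1 p.2.1 p.2.2) p).comp spatialProj)
      (slicePoint h p) :=
  (ContinuousLinearMap.proj (R := ℝ) (φ := fun _ : Fin 4 => ℝ) 0).hasFDerivAt.sub
    (HasFDerivAt.comp (g := fun p : ℝ × ℝ × ℝ => h p.1 p.2.1 p.2.2) (slicePoint h p)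
      (hh.differentiableAt hp).hasFDerivAt spatialProj.hasFDerivAt)

lemma fluxDensity_eq (hh : IsSlice rH h) (g : (Fin 4 → ℝ) → Matrix (Fin 4) (Fin 4) ℝ)
    (S : (Fin 4 → ℝ) → ℝ) {p : ℝ × ℝ × ℝ} (hp : p ∈ sliceChart rH) :
    fluxDensity g Ω h S p
      = S (slicePoint h p) * volDensity g (slicePoint h p) * sliceWeight Ω h p := by
  have pd_time : pd 0 (fun y => y 0 - h (y 1) (y 2) (y 3)) (slicePoint h p) = 1 := by
    have zero_eq : ((0, 0, 0) : ℝ × ℝ × ℝ) = 0 := rfl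
    rw [pd, (hh.hasFDerivAt_time_sub hp).fderiv]
    simp [spatialProj, zero_eq]
  have pd_azimuth : pd 3 (fun y => y 0 - h (y 1) (y 2) (y 3)) (slicePoint h p)
      = -deriv (h p.1 p.2.1) p.2.2 := by
    rw [pd, (hh.hasFDerivAt_time_sub hp).fderiv, (hh.hasDerivAt hp).deriv]
    simp [spatialProj]
  simp only [fluxDensity, surfaceElement, sliceWeight, Fin.sum_univ_four, pd_time, pd_azimuth,
    Matrix.cons_val]
  ring

end IsSlice

section Flux

variable {m : HTMetric} {rH ε : ℝ} {v : ℝ → ℝ → ℝ} {G : ℝ × ℝ → ℝ} {h : ℝ → ℝ → ℝ → ℝ}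

lemma IsSourceDensity.eqOn_fluxDensity (hG : IsSourceDensity m rH ε v G) (hh : IsSlice rH h)
    (Ω : ℝ) :
    EqOn (fun p => G (p.1, p.2.1) * sliceWeight Ω h p)
      (fluxDensity m.g Ω h fun x => ε * (pontryagin m.g x * lift v x)) (sliceDomain rH) :=
  fun p hp => by
    rw [hh.fluxDensity_eq _ _ (sliceDomain_subset_sliceChart rH hp),
      ← hG.eq _ ⟨hp.1, hp.2.1.1, hp.2.1.2⟩]
    rfl

lemma IsSourceDensity.integrableOn_mul_sliceWeight (hG : IsSourceDensity m rH ε v G)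
    (hr : 0 < rH) {D : ℝ} (hD : ∀ r θ, rH < r → θ ∈ Ioo 0 π → |G (r, θ)| ≤ D * r ^ (-2 : ℤ))
    (hh : IsSlice rH h) (Ω : ℝ) :
    IntegrableOn (fun p => G (p.1, p.2.1) * sliceWeight Ω h p) (sliceDomain rH) := by
  obtain ⟨K, hK⟩ := hh.exists_abs_sliceWeight_le (Ω := Ω)
  have cont : ContinuousOn (fun p : ℝ × ℝ × ℝ => G (p.1, p.2.1) * sliceWeight Ω h p)
      (sliceDomain rH) :=
    (hG.continuousOn.comp (by fun_prop) fun p hp => (le_of_lt hp.1 : rH ≤ p.1)).mul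
      (hh.continuousOn_sliceWeight.mono (sliceDomain_subset_sliceChart rH))
  refine integrableOn_prod_of_abs_le measurableSet_Ioi (measurableSet_Ioo.prod measurableSet_Ioo)
    ?_ (cont.aestronglyMeasurable (measurableSet_sliceDomain rH))
    (integrableOn_const_mul_zpow_neg_two hr (D * K)) fun p hp => ?_
  · exact ((Metric.isBounded_Ioo _ _).prod (Metric.isBounded_Ioo _ _)).measure_lt_top
  · have bound := hD p.1 p.2.1 hp.1 hp.2.1
    rw [abs_mul, mul_right_comm]
    exact mul_le_mul bound (hK p (sliceDomain_subset_sliceChart rH hp)) (abs_nonneg _)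
      ((abs_nonneg _).trans bound)

lemma IsSourceDensity.integrableOn (hG : IsSourceDensity m rH ε v G) (hr : 0 < rH) {D : ℝ}
    (hD : ∀ r θ, rH < r → θ ∈ Ioo 0 π → |G (r, θ)| ≤ D * r ^ (-2 : ℤ)) :
    IntegrableOn G (Ioi rH ×ˢ Ioo 0 π) :=
  integrableOn_prod_of_abs_le measurableSet_Ioi measurableSet_Ioo (by simp)
    ((hG.continuousOn.mono fun p hp => (le_of_lt hp.1 : rH ≤ p.1)).aestronglyMeasurable
      (measurableSet_Ioi.prod measurableSet_Ioo))
    (integrableOn_const_mul_zpow_neg_two hr D) fun p hp => hD p.1 p.2 hp.1 hp.2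

lemma IsSourceDensity.integral_fluxDensity (hG : IsSourceDensity m rH ε v G) (hr : 0 < rH)
    {D : ℝ} (hD : ∀ r θ, rH < r → θ ∈ Ioo 0 π → |G (r, θ)| ≤ D * r ^ (-2 : ℤ)) {I : ℝ}
    (hI : Tendsto (fun R => ∫ r in rH..R, ∫ θ in (0 : ℝ)..π, G (r, θ)) atTop (𝓝 I))
    (hh : IsSlice rH h) (Ω : ℝ) :
    ε * ∫ p in sliceDomain rH, fluxDensity m.g Ω h (fun x => pontryagin m.g x * lift v x) p
      = 2 * π * I := by
  rw [← integral_sliceDomain (hG.integrableOn hr hD)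
      (hG.integrableOn_mul_sliceWeight hr hD hh Ω) (fun r θ => hh.integral_sliceWeight) hI,
    setIntegral_congr_fun (measurableSet_sliceDomain rH) (hG.eqOn_fluxDensity hh Ω),
    ← integral_const_mul]
  simp only [fluxDensity, mul_assoc]

end Flux

lemma IsGreenSolution.integral_fluxDensity {m : HTMetric} {rH ε : ℝ} {Φ : ℝ → ℝ → ℝ}
    (hm : IsRegularExterior m rH) (hflat : IsAsymptoticallyFlat m)
    (hfall : FallsOff rH (pontryagin m.g)) (hΦ : ∃ b, ExtendsSmoothly rH Φ b)
    (heq : SolvesDCS m rH ε Φ) {c : ℝ}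
    (hexp : HasLeadingTermC1 (-2) (fun θ => c * Real.cos θ) (Function.uncurry Φ))
    {φ₀ : ℝ → ℝ → ℝ} (hφ : IsGreenSolution m rH φ₀) {h : ℝ → ℝ → ℝ → ℝ} (hh : IsSlice rH h)
    (Ω : ℝ) :
    IntegrableOn (fluxDensity m.g Ω h fun x => ε * (pontryagin m.g x * lift φ₀ x))
      (sliceDomain rH) ∧
    ε * ∫ p in sliceDomain rH, fluxDensity m.g Ω h (fun x => pontryagin m.g x * lift φ₀ x) p
      = 4 * π * c := by
  have hφ_smooth : ∃ b, ExtendsSmoothly rH φ₀ b := hφ.regular.1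
  have hφ_leading := hφ.hasLeadingTermC1 hm.rH_pos.le hφ_smooth.choose_spec.smoothNear
  obtain ⟨G, hG, hflux⟩ :=
    exists_isSourceDensity_tendsto_integral hm hflat hΦ heq hexp hφ_smooth hφ.homogeneous hφ_leading
  obtain ⟨D, hD⟩ := hG.exists_abs_le hm hflat hfall hφ_leading.value
  norm_num only [Int.reduceSub] at hD
  refine ⟨(hG.integrableOn_mul_sliceWeight hm.rH_pos hD hh Ω).congr_fun
    (hG.eqOn_fluxDensity hh Ω) (measurableSet_sliceDomain rH), ?_⟩
  rw [hG.integral_fluxDensity hm.rH_pos hD hflux hh Ω]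
  ring

end DCS

theorem mainTheorem8_general (m : DCS.HTMetric) (rH Ω ε : ℝ)
    (hm : DCS.IsRegularExterior m rH) (hflat : DCS.IsAsymptoticallyFlat m)
    (hfall : DCS.FallsOff rH (DCS.pontryagin m.g))
    (Φ : ℝ → ℝ → ℝ) (hreg : ∃ b, DCS.ExtendsSmoothly rH Φ b) (heq : DCS.SolvesDCS m rH ε Φ)
    (μ₁ μ₂ : ℝ → ℝ) (hμ₁ : DCS.RegularAngular μ₁) (hμ₂ : DCS.RegularAngular μ₂)
    (hexp : DCS.IsRemainder 3 (fun r θ => Φ r θ - (μ₁ θ / r + μ₂ θ / r ^ 2))) :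
    (∀ θ, μ₁ θ = 0) ∧
    DCS.mode 0 μ₂ = 0 ∧
    (∀ θ, μ₂ θ = DCS.mode 1 μ₂ * DCS.legendreP 1 (Real.cos θ)) ∧
    DCS.IsRemainder 3
      (fun r θ => Φ r θ - DCS.mode 1 μ₂ * DCS.legendreP 1 (Real.cos θ) / r ^ 2) ∧
    ∀ φ₀ : ℝ → ℝ → ℝ, DCS.IsGreenSolution m rH φ₀ →
    ∀ h : ℝ → ℝ → ℝ → ℝ, DCS.IsSlice rH h →
      MeasureTheory.IntegrableOn
        (DCS.fluxDensity m.g Ω h (fun x => ε * (DCS.pontryagin m.g x * DCS.lift φ₀ x)))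
        (DCS.sliceDomain rH) ∧
      DCS.mode 1 μ₂ = ε / (4 * Real.pi) *
        ∫ p in DCS.sliceDomain rH,
          DCS.fluxDensity m.g Ω h (fun x => DCS.pontryagin m.g x * DCS.lift φ₀ x) p := by
  have hr : 0 ≤ rH := hm.rH_pos.le
  have hΦ : DCS.SmoothNear (DCS.outside rH) (Function.uncurry Φ) := hreg.choose_spec.smoothNear
  have monopole : μ₁ = fun _ => 0 := DCS.monopole_eq_zero hm hflat hfall hreg heq hμ₁
    (DCS.hasLeadingTermC2_of_scalar_expansion hr hΦ hμ₁ hμ₂ hexp)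
  simp only [monopole, zero_div, zero_add] at hexp
  have hexp_dipole := DCS.hasLeadingTermC2_of_dipole_expansion hr hΦ hμ₂ hexp
  have dipole : μ₂ = fun θ => DCS.mode 1 μ₂ * Real.cos θ :=
    DCS.dipole_eq_mul_cos hm hflat hfall hΦ heq hμ₂ hexp_dipole
  simp only [DCS.legendreP_one]
  refine ⟨congrFun monopole, ?_, congrFun dipole, ?_, fun φ₀ hφ h hh => ?_⟩
  · rw [dipole, DCS.mode_zero_mul_cos]
  · simpa only [← congrFun dipole] using hexp
  · have hleading := hexp_dipole.toHasLeadingTermC1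
    rw [dipole] at hleading
    obtain ⟨integrable, integral_eq⟩ :=
      hφ.integral_fluxDensity hm hflat hfall hreg heq hleading hh Ω
    refine ⟨integrable, ?_⟩
    rw [div_mul_eq_mul_div, integral_eq]
    field_simp

theorem mainTheorem8 (m : DCS.HTMetric) (rH ΩH M J ε : ℝ)
    (hBH : DCS.IsBlackHole m rH ΩH) (hAMC : DCS.IsAMC m M J)
    (hfall : DCS.FallsOff rH (DCS.pontryagin m.g))
    (Φ : ℝ → ℝ → ℝ) (hreg : DCS.RegularScalar rH Φ) (heq : DCS.SolvesDCS m rH ε Φ)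
    (μ₁ μ₂ : ℝ → ℝ) (hμ₁ : DCS.RegularAngular μ₁) (hμ₂ : DCS.RegularAngular μ₂)
    (hexp : DCS.IsRemainder 3 (fun r θ => Φ r θ - (μ₁ θ / r + μ₂ θ / r ^ 2))) :
    (∀ θ, μ₁ θ = 0) ∧
    DCS.mode 0 μ₂ = 0 ∧
    (∀ θ, μ₂ θ = DCS.mode 1 μ₂ * DCS.legendreP 1 (Real.cos θ)) ∧
    DCS.IsRemainder 3
      (fun r θ => Φ r θ - DCS.mode 1 μ₂ * DCS.legendreP 1 (Real.cos θ) / r ^ 2) ∧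
    ∀ φ₀ : ℝ → ℝ → ℝ, DCS.IsGreenSolution m rH φ₀ →
    ∀ h : ℝ → ℝ → ℝ → ℝ, DCS.IsSlice rH h →
      MeasureTheory.IntegrableOn
        (DCS.fluxDensity m.g ΩH h (fun x => ε * (DCS.pontryagin m.g x * DCS.lift φ₀ x)))
        (DCS.sliceDomain rH) ∧
      DCS.mode 1 μ₂ = ε / (4 * Real.pi) *
        ∫ p in DCS.sliceDomain rH,
          DCS.fluxDensity m.g ΩH h (fun x => DCS.pontryagin m.g x * DCS.lift φ₀ x) p :=
  mainTheorem8_general m rH ΩH ε hBH.isRegularExterior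
    (hAMC.isAsymptoticallyFlat hBH.isRegularExterior) hfall Φ hreg.1 heq μ₁ μ₂ hμ₁ hμ₂ hexp
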